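/- Call a set $C\subset\mathbb C$ an analytic Jordan arc if $C=\gamma([0,1])$ for some $\gamma$ that is real-analytic on a neighbourhood of $[0,1]$, injective on $[0,1]$ and satisfies $\gamma'(t)\neq0$ for all $t\in[0,1]$; the endpoints of $C$ are $\gamma(0)$ and $\gamma(1)$. Say that a set consists of $k$ analytic Jordan arcs if it is the union of $k$ analytic Jordan arcs, any two of which meet in at most finitely many points. Let $T_n$ be a complex polynomial of degree $n\ge1$, and let $S=T_n^{-1}([-1,1])=\{z\in\mathbb C: T_n(z)\in[-1,1]\}$. (i) For every integer $\nu\ge0$ and all $b_1,\dots,b_{2\nu}\in\mathbb C$ (not necessarily distinct), the following are equivalent: (a) $S$ consists of $\nu$ analytic Jordan arcs such that the list of the $2\nu$ endpoints of these arcs (each point listed as often as it is an endpoint of one of the arcs) is, up to order, $b_1,\dots,b_{2\nu}$, and $S$ does not consist of fewer than $\nu$ analytic Jordan arcs; (b) the zeros of odd multiplicity of $T_n^2-1$, written according to their multiplicity, are exactly $b_1,\dots,b_{2\nu}$, up to order. (ii) If $S$ is the union of $k$ analytic Jordan arcs, which may overlap, then the number of zeros of odd multiplicity of $T_n^2-1$,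 counted with multiplicity, is at most $2k$. (iii) Arcs can be merged only at zeros of even multiplicity: if $C,C'\subseteq S$ are analytic Jordan arcs whose endpoints are zeros of $T_n^2-1$, if $C\cap C'$ is finite, and if $C\cup C'$ is an analytic Jordan arc, then $C\cap C'=\{z_0\}$, where $z_0$ is a common endpoint of $C$ and $C'$ and a zero of $T_n^2-1$ of even multiplicity. -/

import Mathlib

/-- `γ`, restricted to `[0,1]`, is a regular real-analytic injective parametrisation (analytic on a
neighbourhood of `[0,1]`, with nonvanishing derivative); the endpoints are `γ 0` and `γ 1`. -/
structure IsAnalyticArcParam (γ : ℝ → ℂ) : Prop where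
  analytic : AnalyticOnNhd ℝ γ (Set.Icc 0 1)
  injective : Set.InjOn γ (Set.Icc 0 1)
  regular : ∀ t ∈ Set.Icc (0 : ℝ) 1, deriv γ t ≠ 0

/-- The set of points traced by a parametrised arc. -/
def arcTrace (γ : ℝ → ℂ) : Set ℂ := γ '' Set.Icc 0 1

/-- A set is an analytic Jordan arc if it has an analytic parametrisation as above. -/
def IsAnalyticJordanArc (C : Set ℂ) : Prop :=
  ∃ γ : ℝ → ℂ, IsAnalyticArcParam γ ∧ arcTrace γ = C

/-- The `k` analytic Jordan arcs `γ i` have union `S` (they may overlap arbitrarily). -/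
structure IsArcCover (S : Set ℂ) {k : ℕ} (γ : Fin k → ℝ → ℂ) : Prop where
  arc : ∀ i, IsAnalyticArcParam (γ i)
  union : ⋃ i, arcTrace (γ i) = S

/-- `S` consists of the `k` analytic Jordan arcs `γ i`: it is their union, and any two of them meet
in at most finitely many points (they may cross or touch, but do not overlap). -/
structure IsArcDecomposition (S : Set ℂ) {k : ℕ} (γ : Fin k → ℝ → ℂ) : Prop
    extends IsArcCover S γ where
  finite_inter : ∀ i j, i ≠ j → (arcTrace (γ i) ∩ arcTrace (γ j)).Finite

/-- The `2k` endpoints of `k` arcs: a point is listed as often as it is an endpoint of an arc. -/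
def arcEndpoints {k : ℕ} (γ : Fin k → ℝ → ℂ) : Multiset ℂ :=
  Finset.univ.val.map (fun i => γ i 0) + Finset.univ.val.map (fun i => γ i 1)

/-- The inverse image of the real interval `[-1,1]` under a complex polynomial. -/
def inverseImage (T : Polynomial ℂ) : Set ℂ :=
  {z | ∃ x ∈ Set.Icc (-1 : ℝ) 1, T.eval z = (x : ℂ)}

/-- The zeros of odd multiplicity of a polynomial, listed according to their multiplicity. -/
noncomputable def oddZeros (Q : Polynomial ℂ) : Multiset ℂ :=
  Q.roots.filter (fun z => Odd (Q.rootMultiplicity z))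

open Filter Topology Set

/-! Near a point `z₀` of `S`, a local coordinate `φ` turns `T` into `T z₀ + φ ^ m`, so `S` becomes a
star of straight rays on which `φ ^ m` is real with an admissible sign. If `T z₀` is not `±1`, or if
`m` is even, the rays occur in opposite pairs, and a curve can run through `z₀`. If `T z₀ = ±1` and
`m` is odd, there are `m` rays and none has its opposite in the star, so no regular curve in `S`
passes through `z₀`. Each ray must then be supplied by the end of some arc. Hence every cover by
arcs, even overlapping ones, has the odd zeros among its endpoints with multiplicity
(`IsArcCover.oddZeros_le`), and comparing cardinalities gives the lower bound on the number of arcs.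

For the converse, take a cover by the least number of arcs. Two arcs in `S` that meet with parallel
tangents have an analytic Jordan arc as their union (`isAnalyticJordanArc_union`): with unit speed
they have the same germ, hence glue to one immersed curve, and an immersed curve on which `T` is
real cannot close up (`injOn_of_im_eval_eq_zero`). So a minimal cover has no parallel contacts. This
makes the intersections finite (`NoParallelContact.finite_inter`). It also forbids ends anywhere but
at odd zeros, where distinct ends have distinct directions among the `m` rays
(`IsArcCover.arcEndpoints_le`). The two inequalities of multisets give equality.

The merging statement is the parity observation again: the common endpoint is interior to the merged
arc, so its multiplicity is even. -/

/-! ### Real-analytic functions of one variable: primitives and inverses -/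

/-- The same coefficients serve as a complex power series: convergence at one positive real `r`
bounds the terms there, so the complex radius is at least `r`. -/
theorem AnalyticAt.exists_complex_extension {g : ℝ → ℝ} {x : ℝ} (hg : AnalyticAt ℝ g x) :
    ∃ G : ℂ → ℂ, AnalyticAt ℂ G x ∧ ∀ᶠ y : ℝ in 𝓝 x, G y = g y := by
  obtain ⟨p, hp⟩ := hg
  rw [hasFPowerSeriesAt_iff] at hp
  obtain ⟨ε, hε, hsum⟩ := Metric.eventually_nhds_iff.1 hp
  set q : FormalMultilinearSeries ℂ ℂ ℂ :=
    FormalMultilinearSeries.ofScalars ℂ (fun n => (p.coeff n : ℂ)) with hq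
  set r : ℝ := ε / 2 with hr
  have hr0 : 0 < r := by positivity
  have hs := (hsum (y := r) (by simp [abs_of_pos hr0]; linarith)).summable
  obtain ⟨C, hC⟩ := hs.tendsto_atTop_zero.norm.bddAbove_range
  have hrad : (Real.toNNReal r : ENNReal) ≤ q.radius := by
    refine q.le_radius_of_bound C fun n => ?_
    have := hC ⟨n, rfl⟩
    simp only [norm_smul, norm_pow, Real.norm_eq_abs, abs_of_pos hr0] at this
    rw [hq, FormalMultilinearSeries.ofScalars_norm, Complex.norm_real, Real.coe_toNNReal _ hr0.le,
      Real.norm_eq_abs, mul_comm]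
    exact this
  have hpos : 0 < q.radius := lt_of_lt_of_le (by simpa using hr0) hrad
  have hball := q.hasFPowerSeriesOnBall hpos
  refine ⟨fun z => q.sum (z - x), ?_, ?_⟩
  · have h1 : AnalyticAt ℂ q.sum ((x : ℂ) - x) := by simpa using hball.analyticAt
    exact AnalyticAt.fun_comp (f := fun z : ℂ => z - x) h1 (analyticAt_id.fun_sub analyticAt_const)
  · filter_upwards [Metric.ball_mem_nhds x hr0] with y hy
    have hy' : |y - x| < r := by simpa [Real.dist_eq] using hy
    have h1 := hsum (y := y - x) (by simp; linarith)
    have h2 : HasSum (fun n : ℕ => (((y - x) ^ n • p.coeff n : ℝ) : ℂ)) ((g (x + (y - x)) : ℝ) : ℂ) :=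
      Complex.hasSum_ofReal.2 h1
    have h3 := q.hasSum (x := ((y : ℂ) - x)) (by
      rw [mem_eball_zero_iff]
      refine lt_of_lt_of_le ?_ hrad
      rw [← Complex.ofReal_sub, ← ofReal_norm, Complex.norm_real, Real.norm_eq_abs]
      exact (ENNReal.ofReal_lt_ofReal_iff hr0).2 hy')
    have h4 : (fun n : ℕ => q n fun _ => ((y : ℂ) - x)) =
        fun n : ℕ => (((y - x) ^ n • p.coeff n : ℝ) : ℂ) := by
      funext n
      rw [hq, FormalMultilinearSeries.ofScalars_apply_eq]
      simp [mul_comm]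
    rw [h4] at h3
    have := h3.unique h2
    simpa using this

/-- Extend `g` to a complex disc and take a holomorphic primitive `F`; on the real line `f - Re F`
has derivative zero. This makes arc length analytic. -/
theorem AnalyticAt.of_eventually_hasDerivAt {f g : ℝ → ℝ} {x : ℝ} (hg : AnalyticAt ℝ g x)
    (hf : ∀ᶠ y in 𝓝 x, HasDerivAt f (g y) y) : AnalyticAt ℝ f x := by
  obtain ⟨G, hG, hGg⟩ := hg.exists_complex_extension
  obtain ⟨r, hr, hGr⟩ := Metric.eventually_nhds_iff_ball.1 hG.eventually_analyticAt
  have hd : DifferentiableOn ℂ G (Metric.ball (x : ℂ) r) := fun z hz =>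
    (hGr z hz).differentiableAt.differentiableWithinAt
  obtain ⟨F, hF⟩ := hd.isExactOn_ball
  have hFan : AnalyticAt ℂ F x := by
    refine DifferentiableOn.analyticAt (s := Metric.ball (x : ℂ) r)
      (fun z hz => (hF z hz).differentiableAt.differentiableWithinAt)
      (Metric.ball_mem_nhds _ hr)
  have hre : AnalyticAt ℝ (fun y : ℝ => (F y).re) x := by
    have h1 : AnalyticAt ℝ F (x : ℂ) := hFan.restrictScalars
    have h2 : AnalyticAt ℝ (fun y : ℝ => (y : ℂ)) x := Complex.ofRealCLM.analyticAt x
    exact (Complex.reCLM.analyticAt _).comp (h1.comp h2)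
  obtain ⟨s, hs, h⟩ := Metric.eventually_nhds_iff_ball.1 (hGg.and hf)
  set ρ := min r s
  have hρ : 0 < ρ := lt_min hr hs
  have hder : ∀ y ∈ Metric.ball x ρ, HasDerivAt (fun y => f y - (F y).re) 0 y := by
    intro y hy
    have hy1 : (y : ℂ) ∈ Metric.ball (x : ℂ) r := by
      have := Metric.ball_subset_ball (min_le_left r s) hy
      rw [Metric.mem_ball] at this ⊢
      rwa [Complex.dist_of_im_eq (by simp)]
    have hy2 := h y (Metric.ball_subset_ball (min_le_right r s) hy)
    have h1 := (hF y hy1).real_of_complex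
    rw [hy2.1] at h1
    simpa using hy2.2.fun_sub h1
  have hconst : ∀ y ∈ Metric.ball x ρ, f y - (F y).re = f x - (F x).re := by
    intro y hy
    exact Metric.isOpen_ball.is_const_of_deriv_eq_zero (convex_ball x ρ).isPreconnected
      (fun z hz => (hder z hz).differentiableAt.differentiableWithinAt)
      (fun z hz => (hder z hz).deriv) hy (Metric.mem_ball_self hρ)
  have : AnalyticAt ℝ (fun y : ℝ => (F y).re + (f x - (F x).re)) x := hre.add analyticAt_const
  refine this.congr ?_
  filter_upwards [Metric.ball_mem_nhds x hρ] with y hy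
  have := hconst y hy
  linarith

theorem AnalyticAt.of_leftInverse {f g : ℝ → ℝ} {x : ℝ} (hf : AnalyticAt ℝ f x)
    (hx : deriv f x ≠ 0) (hg : Function.LeftInverse g f) :
    AnalyticAt ℝ g (f x) ∧ HasDerivAt g (deriv f x)⁻¹ (f x) := by
  have hev : (hf.hasStrictDerivAt.localInverse _ _ _ hx) =ᶠ[𝓝 (f x)] g := by
    filter_upwards [hf.hasStrictDerivAt.eventually_right_inverse hx] with y hy
    conv_rhs => rw [← hy, hg]
  exact ⟨(hf.analyticAt_localInverse hx).congr hev,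
    (hf.hasStrictDerivAt.to_localInverse hx).hasDerivAt.congr_of_eventuallyEq hev.symm⟩

/-! ### Arc length parametrisation -/

/-- `σ` is analytic with unit speed on `[a, b]`. -/
structure IsUnitSpeed (σ : ℝ → ℂ) (a b : ℝ) : Prop where
  analytic : AnalyticOnNhd ℝ σ (Icc a b)
  speed : ∀ t ∈ Icc a b, ‖deriv σ t‖ = 1

theorem AnalyticAt.norm_complex {f : ℝ → ℂ} {t : ℝ} (hf : AnalyticAt ℝ f t) (h0 : f t ≠ 0) :
    AnalyticAt ℝ (fun s => ‖f s‖) t := by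
  have hre : AnalyticAt ℝ (fun s => (f s).re) t := (Complex.reCLM.analyticAt _).comp hf
  have him : AnalyticAt ℝ (fun s => (f s).im) t := (Complex.imCLM.analyticAt _).comp hf
  have hn : AnalyticAt ℝ (fun s => (f s).re * (f s).re + (f s).im * (f s).im) t :=
    (hre.mul hre).add (him.mul him)
  have hpos : 0 < (f t).re * (f t).re + (f t).im * (f t).im := by
    have := Complex.normSq_pos.2 h0
    rwa [Complex.normSq_apply] at this
  have hsq : AnalyticAt ℝ Real.sqrt ((f t).re * (f t).re + (f t).im * (f t).im) :=
    (Real.contDiffAt_sqrt (n := ⊤) hpos.ne').analyticAt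
  have := hsq.comp (f := fun s => (f s).re * (f s).re + (f s).im * (f s).im) hn
  refine this.congr (Eventually.of_forall fun s => ?_)
  simp [Complex.norm_eq_sqrt_sq_add_sq, sq]

theorem exists_Icc_subset_of_isOpen {a b : ℝ} (hab : a ≤ b) {U : Set ℝ} (hU : IsOpen U)
    (h : Icc a b ⊆ U) : ∃ δ > 0, Icc (a - δ) (b + δ) ⊆ U := by
  obtain ⟨δ, hδ, hδU⟩ := isCompact_Icc.exists_cthickening_subset_open hU h
  refine ⟨δ, hδ, fun t ht => hδU ?_⟩
  rcases lt_or_ge t a with h1 | h1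
  · exact Metric.mem_cthickening_of_dist_le t a δ _ (left_mem_Icc.2 hab)
      (by rw [Real.dist_eq, abs_le]; constructor <;> linarith [ht.1])
  rcases lt_or_ge b t with h2 | h2
  · exact Metric.mem_cthickening_of_dist_le t b δ _ (right_mem_Icc.2 hab)
      (by rw [Real.dist_eq, abs_le]; constructor <;> linarith [ht.2])
  · exact Metric.mem_cthickening_of_dist_le t t δ _ ⟨h1, h2⟩ (by simp [hδ.le])

/-- Arc length reparametrisation of an analytic arc. -/
theorem IsAnalyticArcParam.exists_isUnitSpeed {γ : ℝ → ℂ} (hγ : IsAnalyticArcParam γ) :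
    ∃ L > 0, ∃ σ : ℝ → ℂ, IsUnitSpeed σ 0 L ∧ σ '' Icc 0 L = arcTrace γ ∧
      ∀ t ∈ Icc (0 : ℝ) 1, ∃ s ∈ Icc 0 L, σ s = γ t ∧ ∃ c : ℝ, c ≠ 0 ∧
        deriv γ t = c * deriv σ s := by
  set U : Set ℝ := {t | AnalyticAt ℝ γ t ∧ deriv γ t ≠ 0} with hUdef
  have hU : IsOpen U := by
    rw [isOpen_iff_eventually]
    rintro t ⟨h1, h2⟩
    exact h1.eventually_analyticAt.and (h1.deriv.continuousAt.eventually_ne h2)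
  obtain ⟨δ, hδ, hδU⟩ := exists_Icc_subset_of_isOpen zero_le_one hU
    (fun t ht => ⟨hγ.analytic t ht, hγ.regular t ht⟩)
  have hle : (0 - δ : ℝ) ≤ 1 + δ := by linarith
  -- Freezing the speed outside the enlarged interval makes it continuous and positive on all of
  -- `ℝ`, so that arc length is strictly increasing there and has a global left inverse.
  set v : ℝ → ℝ := fun t => ‖deriv γ (projIcc (0 - δ) (1 + δ) hle t)‖ with hv
  have hvc : Continuous v := by
    refine continuous_norm.comp ?_
    have : ContinuousOn (deriv γ) (Icc (0 - δ) (1 + δ)) := fun t ht =>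
      (hδU ht).1.deriv.continuousAt.continuousWithinAt
    exact (continuousOn_iff_continuous_domRestrict.1 this).comp continuous_projIcc
  have hvpos : ∀ t, 0 < v t := fun t => norm_pos_iff.2 (hδU (Subtype.mem _)).2
  have hveq : ∀ t ∈ Icc (0 - δ) (1 + δ), v t = ‖deriv γ t‖ := by
    intro t ht
    simp only [hv]
    rw [projIcc_of_mem hle ht]
  set l : ℝ → ℝ := fun t => ∫ s in (0 : ℝ)..t, v s with hl
  have hld : ∀ t, HasDerivAt l (v t) t := fun t =>
    intervalIntegral.integral_hasDerivAt_right (hvc.intervalIntegrable _ _)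
      (hvc.stronglyMeasurableAtFilter _ _) hvc.continuousAt
  have hmono : StrictMono l := strictMono_of_deriv_pos fun t => by
    rw [(hld t).deriv]; exact hvpos t
  have hl0 : l 0 = 0 := by simp [hl]
  set g := Function.invFun l with hg
  have hgl : Function.LeftInverse g l := Function.leftInverse_invFun hmono.injective
  have hnhds : ∀ t ∈ Icc (0 : ℝ) 1, Icc (0 - δ) (1 + δ) ∈ 𝓝 t := fun t ht =>
    Icc_mem_nhds (by linarith [ht.1]) (by linarith [ht.2])
  have hlan : ∀ t ∈ Icc (0 : ℝ) 1, AnalyticAt ℝ l t := by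
    intro t ht
    have htU := hδU (mem_of_mem_nhds (hnhds t ht))
    have h1 := htU.1.deriv.norm_complex htU.2
    refine (h1.congr ?_).of_eventually_hasDerivAt (Eventually.of_forall hld)
    filter_upwards [hnhds t ht] with s hs using (hveq s hs).symm
  have key : ∀ t ∈ Icc (0 : ℝ) 1, AnalyticAt ℝ (γ ∘ g) (l t) ∧ (γ ∘ g) (l t) = γ t ∧
      HasDerivAt (γ ∘ g) (((v t)⁻¹ : ℝ) • deriv γ t) (l t) := by
    intro t ht
    obtain ⟨h1, h2⟩ := (hlan t ht).of_leftInverse (by rw [(hld t).deriv]; exact (hvpos t).ne') hgl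
    rw [(hld t).deriv] at h2
    have h3 : AnalyticAt ℝ γ (g (l t)) := by rw [hgl]; exact hγ.analytic t ht
    refine ⟨h3.comp h1, by simp [hgl t], ?_⟩
    have h4 := h3.differentiableAt.hasDerivAt.scomp (l t) h2
    rwa [hgl] at h4
  have hsurj : ∀ s ∈ Icc 0 (l 1), ∃ t ∈ Icc (0 : ℝ) 1, l t = s := by
    intro s hs
    have := intermediate_value_Icc (zero_le_one (α := ℝ))
      (fun t _ => (hld t).continuousAt.continuousWithinAt)
    rw [hl0] at this
    exact this hs
  have hmem : ∀ t ∈ Icc (0 : ℝ) 1, l t ∈ Icc 0 (l 1) := fun t ht =>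
    ⟨by rw [← hl0]; exact hmono.monotone ht.1, hmono.monotone ht.2⟩
  refine ⟨l 1, by rw [← hl0]; exact hmono zero_lt_one, γ ∘ g, ⟨?_, ?_⟩, ?_, ?_⟩
  · intro s hs
    obtain ⟨t, ht, rfl⟩ := hsurj s hs
    exact (key t ht).1
  · intro s hs
    obtain ⟨t, ht, rfl⟩ := hsurj s hs
    rw [(key t ht).2.2.deriv, norm_smul, ← hveq t (mem_of_mem_nhds (hnhds t ht))]
    simp [abs_of_pos (hvpos t), (hvpos t).ne']
  · ext z
    constructor
    · rintro ⟨s, hs, rfl⟩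
      obtain ⟨t, ht, rfl⟩ := hsurj s hs
      exact ⟨t, ht, (key t ht).2.1.symm⟩
    · rintro ⟨t, ht, rfl⟩
      exact ⟨l t, hmem t ht, (key t ht).2.1⟩
  · intro t ht
    refine ⟨l t, hmem t ht, (key t ht).2.1, v t, (hvpos t).ne', ?_⟩
    rw [(key t ht).2.2.deriv]
    have := (hvpos t).ne'
    simp [this]

/-! ### Local normal form of a polynomial -/

/-- Near `z₀` the polynomial `T` is `T z₀ + φ ^ m` in the local coordinate `φ`, with inverse `ψ`. -/
structure IsNormalForm (T : Polynomial ℂ) (z₀ : ℂ) (m : ℕ) (φ ψ : ℂ → ℂ) : Prop where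
  pos : 0 < m
  mult : (T - Polynomial.C (T.eval z₀)).rootMultiplicity z₀ = m
  analytic : AnalyticAt ℂ φ z₀
  analytic_symm : AnalyticAt ℂ ψ 0
  apply_base : φ z₀ = 0
  symm_apply_zero : ψ 0 = z₀
  deriv_ne : deriv φ z₀ ≠ 0
  deriv_symm_ne : deriv ψ 0 ≠ 0
  left_inv : ∀ᶠ z in 𝓝 z₀, ψ (φ z) = z
  right_inv : ∀ᶠ w in 𝓝 0, φ (ψ w) = w
  eval_eq : ∀ᶠ z in 𝓝 z₀, T.eval z = T.eval z₀ + φ z ^ m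

theorem exists_isNormalForm {T : Polynomial ℂ} (hT : 0 < T.natDegree) (z₀ : ℂ) :
    ∃ m φ ψ, IsNormalForm T z₀ m φ ψ := by
  set Q := T - Polynomial.C (T.eval z₀) with hQ
  have hQ0 : Q ≠ 0 := by
    intro h
    rw [sub_eq_zero] at h
    rw [h, Polynomial.natDegree_C] at hT
    exact lt_irrefl _ hT
  set m := Q.rootMultiplicity z₀ with hm
  have hm0 : 0 < m := (Polynomial.rootMultiplicity_pos hQ0).2 (by simp [hQ])
  obtain ⟨R, hR, hRd⟩ := Polynomial.exists_eq_pow_rootMultiplicity_mul_and_not_dvd Q hQ0 z₀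
  rw [← hm] at hR
  have hR0 : R.eval z₀ ≠ 0 := fun h => hRd (Polynomial.dvd_iff_isRoot.2 h)
  obtain ⟨c, hc⟩ := IsAlgClosed.exists_pow_nat_eq (R.eval z₀) hm0
  have hc0 : c ≠ 0 := by rintro rfl; rw [zero_pow hm0.ne'] at hc; exact hR0 hc.symm
  -- An analytic `m`-th root of the cofactor `R`: the quotient `R z / R z₀` is near `1`, where the
  -- principal logarithm is analytic.
  set k : ℂ → ℂ := fun z => c * Complex.exp (Complex.log (R.eval z / R.eval z₀) / m) with hk
  have hRan : AnalyticAt ℂ (fun z => R.eval z) z₀ := R.differentiable.analyticAt z₀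
  have hkan : AnalyticAt ℂ k z₀ := by
    refine analyticAt_const.mul (AnalyticAt.cexp' ?_)
    refine AnalyticAt.div_const ?_
    refine AnalyticAt.clog (hRan.div_const) ?_
    simp [div_self hR0]
  have hk0 : k z₀ = c := by simp [hk, div_self hR0]
  have hkm : ∀ᶠ z in 𝓝 z₀, k z ^ m = R.eval z := by
    filter_upwards [hRan.continuousAt.eventually_ne hR0] with z hz
    have hmc : (m : ℂ) ≠ 0 := by exact_mod_cast hm0.ne'
    simp only [hk]
    rw [mul_pow, ← Complex.exp_nat_mul, mul_div_cancel₀ _ hmc,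
      Complex.exp_log (div_ne_zero hz hR0), hc, mul_div_cancel₀ _ hR0]
  set φ : ℂ → ℂ := fun z => (z - z₀) * k z with hφ
  have hφan : AnalyticAt ℂ φ z₀ := (analyticAt_id.sub analyticAt_const).mul hkan
  have hφ0 : φ z₀ = 0 := by simp [hφ]
  have hφd : HasDerivAt φ c z₀ := by
    have := ((hasDerivAt_id' z₀).sub_const z₀).fun_mul hkan.differentiableAt.hasDerivAt
    simpa [hk0] using this
  have hφ' : deriv φ z₀ ≠ 0 := by rwa [hφd.deriv]
  have hst := hφan.hasStrictDerivAt
  set ψ := hst.localInverse _ _ _ hφ' with hψ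
  have hψan : AnalyticAt ℂ ψ 0 := by
    have := hφan.analyticAt_localInverse hφ'
    rwa [hφ0] at this
  have hψ0 : ψ 0 = z₀ := by
    have : ψ (φ z₀) = z₀ := (hst.eventually_left_inverse hφ').self_of_nhds
    rwa [hφ0] at this
  refine ⟨m, φ, ψ, hm0, rfl, hφan, hψan, hφ0, hψ0, hφ', ?_, hst.eventually_left_inverse hφ', ?_, ?_⟩
  · have h := (hst.to_localInverse hφ').hasDerivAt
    rw [hφ0] at h
    rw [h.deriv]
    exact inv_ne_zero hφ'
  · have := hst.eventually_right_inverse hφ'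
    rwa [hφ0] at this
  · filter_upwards [hkm] with z hz
    have h1 : T.eval z - T.eval z₀ = (z - z₀) ^ m * R.eval z := by
      have := congrArg (Polynomial.eval z) hR
      simpa [hQ] using this
    simp only [hφ, mul_pow, hz, ← h1]
    ring

/-! ### Curves on which a polynomial is real do not close up -/

/-- Multiply Bernoulli's bound `1 + k v ≤ (1 + v) ^ k` by `(1 - v) ^ k` and use `(1 - v ^ 2) ^ k ≤
1`. -/
theorem mul_one_sub_pow_le {v : ℝ} (h0 : 0 ≤ v) (h1 : v ≤ 1) {k : ℕ} (hk : 0 < k) :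
    v * (1 - v) ^ k ≤ 1 / k := by
  have hk' : (0 : ℝ) < k := by exact_mod_cast hk
  have hB : 1 + (k : ℝ) * v ≤ (1 + v) ^ k := one_add_mul_le_pow (by linarith) k
  have h2 : (1 - v) ^ k * (1 + v) ^ k ≤ 1 := by
    rw [← mul_pow]
    exact pow_le_one₀ (by nlinarith) (by nlinarith)
  have h3 : 0 ≤ (1 - v) ^ k := pow_nonneg (by linarith) k
  rw [le_div_iff₀ hk']
  nlinarith [mul_le_mul_of_nonneg_left hB h3]

/-- The integrals of `h * (1 - v) ^ k` cannot all vanish when `v` has a zero at `t₀`, `h` is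
positive near `t₀` and `h` is dominated by `v` elsewhere. -/
theorem exists_integral_peak_ne_zero {a b t₀ η M C : ℝ} {h v : ℝ → ℝ}
    (hη : 0 < η) (ha : a ≤ t₀ - η) (hb : t₀ + η ≤ b) (hM : 0 < M)
    (hh : ContinuousOn h (Icc a b)) (hvc : ContinuousOn v (Icc a b))
    (hv0 : ∀ t ∈ Icc a b, 0 ≤ v t) (hv1 : ∀ t ∈ Icc a b, v t ≤ 1)
    (hvM : ∀ t ∈ Icc (t₀ - η) (t₀ + η), v t ≤ (M * (t - t₀)) ^ 2)
    (hh1 : ∀ t ∈ Icc (t₀ - η) (t₀ + η), 1 / 2 ≤ h t) (hC : 0 ≤ C)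
    (hhC : ∀ t ∈ Icc a b, t ∉ Icc (t₀ - η) (t₀ + η) → |h t| ≤ C * v t) :
    ∃ k : ℕ, ∫ t in a..b, h t * (1 - v t) ^ k ≠ 0 := by
  set τ := min η (1 / (2 * M)) with hτ
  have hτ0 : 0 < τ := lt_min hη (by positivity)
  -- With exponent `j ^ 2`, the integrand is at least `3 / 8` within distance `τ / j` of `t₀` and at
  -- least `-C / j ^ 2` everywhere. The peak thus contributes order `1 / j` against a loss of order
  -- `1 / j ^ 2`, and this choice of `j` lets the peak win.
  obtain ⟨j, hj⟩ := exists_nat_gt (max 1 (C * (b - a) / (3 / 4 * τ)))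
  have hj1 : (1 : ℝ) < j := lt_of_le_of_lt (le_max_left _ _) hj
  have hj2 : C * (b - a) < 3 / 4 * τ * j := by
    have := lt_of_le_of_lt (le_max_right _ _) hj
    rw [div_lt_iff₀ (by positivity)] at this
    linarith
  have hjn : 0 < j := by
    have : (0 : ℝ) < j := by linarith
    exact_mod_cast this
  have hj0 : (0 : ℝ) < j := by linarith
  refine ⟨j ^ 2, ?_⟩
  have hk : 0 < j ^ 2 := by positivity
  set ρ := τ / j with hρ
  have hρ0 : 0 < ρ := by positivity
  have hρη : ρ ≤ η := by
    rw [hρ, div_le_iff₀ hj0]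
    have : τ ≤ η := min_le_left _ _
    nlinarith
  have hρM : M * ρ ≤ 1 / (2 * j) := by
    have : τ ≤ 1 / (2 * M) := min_le_right _ _
    rw [hρ, ← mul_div_assoc, div_le_div_iff₀ hj0 (by positivity)]
    rw [le_div_iff₀ (by positivity)] at this
    nlinarith
  set F : ℝ → ℝ := fun t => h t * (1 - v t) ^ (j ^ 2) with hF
  have hFc : ContinuousOn F (Icc a b) := hh.mul ((continuousOn_const.sub hvc).pow _)
  have hlow : ∀ t ∈ Icc a b, -(C / (j : ℝ) ^ 2) ≤ F t := by
    intro t ht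
    have h0 : 0 ≤ (1 - v t) ^ (j ^ 2) := pow_nonneg (by linarith [hv1 t ht]) _
    by_cases hN : t ∈ Icc (t₀ - η) (t₀ + η)
    · have : 0 ≤ F t := mul_nonneg (by linarith [hh1 t hN]) h0
      have : 0 ≤ C / (j : ℝ) ^ 2 := by positivity
      linarith
    · have h1 := (abs_le.1 (hhC t ht hN)).1
      have h2 := mul_one_sub_pow_le (hv0 t ht) (hv1 t ht) hk
      push_cast at h2
      have h3 : C * (v t * (1 - v t) ^ (j ^ 2)) ≤ C * (1 / (j : ℝ) ^ 2) :=
        mul_le_mul_of_nonneg_left h2 hC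
      have h4 : -(C * v t) * (1 - v t) ^ (j ^ 2) ≤ F t := mul_le_mul_of_nonneg_right h1 h0
      have h5 : C / (j : ℝ) ^ 2 = C * (1 / (j : ℝ) ^ 2) := by ring
      rw [h5]
      nlinarith
  have hmid : ∀ t ∈ Icc (t₀ - ρ) (t₀ + ρ), 3 / 8 ≤ F t := by
    intro t ht
    have htN : t ∈ Icc (t₀ - η) (t₀ + η) := ⟨by linarith [ht.1], by linarith [ht.2]⟩
    have htab : t ∈ Icc a b := ⟨ha.trans htN.1, htN.2.trans hb⟩
    have h1 : v t ≤ (1 / (2 * j)) ^ 2 := by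
      refine (hvM t htN).trans ?_
      refine sq_le_sq' ?_ ?_ <;> nlinarith [ht.1, ht.2]
    have h2 : 1 + ((j ^ 2 : ℕ) : ℝ) * (-(v t)) ≤ (1 + -(v t)) ^ (j ^ 2) :=
      one_add_mul_le_pow (by linarith [hv1 t htab]) _
    have h3 : ((j ^ 2 : ℕ) : ℝ) * v t ≤ 1 / 4 := by
      push_cast
      calc (j : ℝ) ^ 2 * v t ≤ (j : ℝ) ^ 2 * (1 / (2 * j)) ^ 2 := by gcongr
        _ = 1 / 4 := by field_simp; norm_num
    have h4 : 3 / 4 ≤ (1 - v t) ^ (j ^ 2) := by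
      rw [sub_eq_add_neg]; linarith
    calc (3 / 8 : ℝ) = 1 / 2 * (3 / 4) := by norm_num
      _ ≤ F t := mul_le_mul (hh1 t htN) h4 (by norm_num) (by linarith [hh1 t htN])
  have ha' : a ≤ t₀ - ρ := by linarith
  have hb' : t₀ + ρ ≤ b := by linarith
  have hm' : t₀ - ρ ≤ t₀ + ρ := by linarith
  have i1 : IntervalIntegrable F MeasureTheory.volume a (t₀ - ρ) :=
    (hFc.mono (Icc_subset_Icc le_rfl (by linarith))).intervalIntegrable_of_Icc ha'
  have i2 : IntervalIntegrable F MeasureTheory.volume (t₀ - ρ) (t₀ + ρ) :=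
    (hFc.mono (Icc_subset_Icc ha' hb')).intervalIntegrable_of_Icc hm'
  have i3 : IntervalIntegrable F MeasureTheory.volume (t₀ + ρ) b :=
    (hFc.mono (Icc_subset_Icc (by linarith) le_rfl)).intervalIntegrable_of_Icc hb'
  have e : ∫ t in a..b, F t = (∫ t in a..(t₀ - ρ), F t) + (∫ t in (t₀ - ρ)..(t₀ + ρ), F t) +
      ∫ t in (t₀ + ρ)..b, F t := by
    rw [intervalIntegral.integral_add_adjacent_intervals i1 i2,
      intervalIntegral.integral_add_adjacent_intervals (i1.trans i2) i3]
  have b1 := intervalIntegral.integral_mono_on ha' intervalIntegrable_const i1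
    (fun t ht => hlow t ⟨ht.1, by linarith [ht.2]⟩)
  have b2 := intervalIntegral.integral_mono_on hm' intervalIntegrable_const i2 hmid
  have b3 := intervalIntegral.integral_mono_on hb' intervalIntegrable_const i3
    (fun t ht => hlow t ⟨by linarith [ht.1], ht.2⟩)
  simp only [intervalIntegral.integral_const, smul_eq_mul] at b1 b2 b3
  have hpos : 0 < ∫ t in a..b, F t := by
    rw [e]
    have hCj : 0 ≤ C / (j : ℝ) ^ 2 := by positivity
    have h6 : C / (j : ℝ) ^ 2 * (b - a) < 3 / 4 * ρ := by
      rw [hρ, ← mul_div_assoc, div_mul_eq_mul_div, div_lt_div_iff₀ (by positivity) hj0]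
      nlinarith
    nlinarith
  exact hpos.ne'

/-- The integral of a polynomial along a closed curve vanishes. -/
theorem integral_polynomial_closed_curve (q : Polynomial ℂ) {γ : ℝ → ℂ} {a b : ℝ} (hab : a ≤ b)
    (hγ : AnalyticOnNhd ℝ γ (Icc a b)) (hcl : γ a = γ b) :
    ∫ t in a..b, q.eval (γ t) * deriv γ t = 0 := by
  obtain ⟨F, hF⟩ := q.differentiable.isExactOn_univ
  have hd : ∀ t ∈ uIcc a b, HasDerivAt (fun s => F (γ s)) (q.eval (γ t) * deriv γ t) t := by
    intro t ht
    rw [uIcc_of_le hab] at ht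
    exact (hF (γ t) (mem_univ _)).comp_of_eq t (hγ t ht).differentiableAt.hasDerivAt rfl
  have hc : ContinuousOn (fun t => q.eval (γ t) * deriv γ t) (uIcc a b) := by
    rw [uIcc_of_le hab]
    exact (q.continuous.comp_continuousOn hγ.continuousOn).mul hγ.deriv.continuousOn
  rw [intervalIntegral.integral_eq_sub_of_hasDerivAt hd hc.intervalIntegrable, hcl, sub_self]

/-- Strict differentiability with nonzero derivative keeps chords near `p` comparable to parameter
differences. It keeps the double points of an immersed curve away from the diagonal. -/
theorem AnalyticAt.eventually_injective {γ : ℝ → ℂ} {p : ℝ} (hγ : AnalyticAt ℝ γ p)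
    (h0 : deriv γ p ≠ 0) : ∀ᶠ x : ℝ × ℝ in 𝓝 (p, p), γ x.1 = γ x.2 → x.1 = x.2 := by
  have h1 := hγ.hasStrictDerivAt
  have h2 := (hasStrictFDerivAt_iff_isLittleO.1 h1).def (half_pos (norm_pos_iff.2 h0))
  filter_upwards [h2] with x hx hxe
  by_contra hne
  rw [hxe, sub_self, zero_sub, norm_neg,
    ContinuousLinearMap.toSpanSingleton_apply, norm_smul] at hx
  have h3 : 0 < ‖x.1 - x.2‖ := norm_pos_iff.2 (sub_ne_zero.2 hne)
  nlinarith [norm_pos_iff.2 h0, mul_pos h3 (norm_pos_iff.2 h0)]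

/-- If an immersed curve is not injective, it contains a loop of minimal length. -/
theorem exists_minimal_loop {γ : ℝ → ℂ} {a b : ℝ} (hγ : AnalyticOnNhd ℝ γ (Icc a b))
    (h0 : ∀ t ∈ Icc a b, deriv γ t ≠ 0) (hinj : ¬ InjOn γ (Icc a b)) :
    ∃ c d, a ≤ c ∧ c < d ∧ d ≤ b ∧ γ c = γ d ∧
      ∀ x ∈ Icc c d, ∀ y ∈ Icc c d, x < y → γ x = γ y → d - c ≤ y - x := by
  -- `W` is open and contains the diagonal of the parameter square, so the double points outside `W`
  -- form a compact set on which the length `y - x` attains its minimum.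
  set W : Set (ℝ × ℝ) := {p | ∀ᶠ x in 𝓝 p, γ x.1 = γ x.2 → x.1 = x.2} with hW
  have hWo : IsOpen W := isOpen_iff_eventually.2 fun p hp => eventually_eventually_nhds.2 hp
  set K : Set (ℝ × ℝ) := ((Icc a b ×ˢ Icc a b) ∩ {p | γ p.1 = γ p.2}) ∩ {p | p.1 ≤ p.2} ∩ Wᶜ with hK
  have hKc : IsCompact K := by
    refine IsCompact.inter_right (IsCompact.inter_right ?_ (isClosed_le continuous_fst continuous_snd))
      hWo.isClosed_compl
    have hcl : IsClosed (Icc a b ×ˢ Icc a b) := isClosed_Icc.prod isClosed_Icc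
    have hf : ContinuousOn (fun p : ℝ × ℝ => γ p.1 - γ p.2) (Icc a b ×ˢ Icc a b) :=
      (hγ.continuousOn.comp continuousOn_fst fun p hp => hp.1).sub
        (hγ.continuousOn.comp continuousOn_snd fun p hp => hp.2)
    have := hf.preimage_isClosed_of_isClosed hcl (isClosed_singleton (x := (0 : ℂ)))
    have e : (Icc a b ×ˢ Icc a b) ∩ {p : ℝ × ℝ | γ p.1 = γ p.2} =
        (Icc a b ×ˢ Icc a b) ∩ (fun p : ℝ × ℝ => γ p.1 - γ p.2) ⁻¹' {0} := by
      ext p; simp [sub_eq_zero]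
    rw [e]
    exact (isCompact_Icc.prod isCompact_Icc).of_isClosed_subset this inter_subset_left
  have hmem : ∀ x ∈ Icc a b, ∀ y ∈ Icc a b, x < y → γ x = γ y → (x, y) ∈ K := by
    intro x hx y hy hxy he
    refine ⟨⟨⟨⟨hx, hy⟩, he⟩, hxy.le⟩, fun hxW => ?_⟩
    exact hxy.ne ((show ∀ᶠ z in 𝓝 (x, y), γ z.1 = γ z.2 → z.1 = z.2 from hxW).self_of_nhds he)
  have hne : K.Nonempty := by
    simp only [InjOn, not_forall] at hinj
    obtain ⟨x, hx, y, hy, he, hxy⟩ := hinj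
    rcases lt_or_gt_of_ne hxy with h | h
    · exact ⟨_, hmem x hx y hy h he⟩
    · exact ⟨_, hmem y hy x hx h he.symm⟩
  obtain ⟨⟨c, d⟩, hcd, hmin⟩ := hKc.exists_isMinOn hne
    (f := fun p : ℝ × ℝ => p.2 - p.1) (continuous_snd.sub continuous_fst).continuousOn
  obtain ⟨⟨⟨⟨hc, hd⟩, he⟩, hle⟩, hnW⟩ := hcd
  simp only [mem_ofPred_eq] at he hle hc hd
  refine ⟨c, d, hc.1, lt_of_le_of_ne hle ?_, hd.2, he, ?_⟩
  · rintro rfl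
    exact hnW ((hγ c hc).eventually_injective (h0 c hc))
  · intro x hx y hy hxy hxe
    exact isMinOn_iff.1 hmin _ (hmem x ⟨hc.1.trans hx.1, hx.2.trans hd.2⟩ y
      ⟨hc.1.trans hy.1, hy.2.trans hd.2⟩ hxy hxe)

/-- An immersed analytic curve on which a nonconstant polynomial is real has no self-intersection. -/
theorem injOn_of_im_eval_eq_zero {T : Polynomial ℂ} (hT : 0 < T.natDegree) {γ : ℝ → ℂ} {a b : ℝ}
    (hγ : AnalyticOnNhd ℝ γ (Icc a b)) (h0 : ∀ t ∈ Icc a b, deriv γ t ≠ 0)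
    (him : ∀ t ∈ Icc a b, (T.eval (γ t)).im = 0) : InjOn γ (Icc a b) := by
  -- On a minimal loop all integrals of polynomials vanish. Since `T` is real on the loop,
  -- polynomials in `T` can act as a real peak kernel that concentrates such an integral at one
  -- point, which contradicts the vanishing.
  by_contra hinj
  obtain ⟨c, d, hac, hcd, hdb, hcl, hmin⟩ := exists_minimal_loop hγ h0 hinj
  have hsub : Icc c d ⊆ Icc a b := Icc_subset_Icc hac hdb
  replace hγ := hγ.mono hsub
  replace h0 := fun t ht => h0 t (hsub ht)
  replace him := fun t ht => him t (hsub ht)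
  have hinjo : ∀ x ∈ Icc c d, ∀ y ∈ Ioo c d, γ x = γ y → x = y := by
    intro x hx y hy he
    by_contra hne
    rcases lt_or_gt_of_ne hne with h | h
    · have := hmin x hx y (Ioo_subset_Icc_self hy) h he
      linarith [hx.1, hy.2]
    · have := hmin y (Ioo_subset_Icc_self hy) x hx h he.symm
      linarith [hx.2, hy.1]
  have hT' : Polynomial.derivative T ≠ 0 := fun h =>
    hT.ne' (Polynomial.derivative_eq_zero.1 h)
  -- The derivative of `T` has finitely many zeros, while the open loop is traced injectively and so
  -- has infinitely many points.
  obtain ⟨t₀, ht₀, hTt⟩ : ∃ t ∈ Ioo c d, (Polynomial.derivative T).eval (γ t) ≠ 0 := by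
    by_contra! hall
    have hfin : (γ '' Ioo c d).Finite := by
      refine ((Polynomial.derivative T).roots.toFinset.finite_toSet).subset ?_
      rintro _ ⟨t, ht, rfl⟩
      simpa [hT'] using hall t ht
    have hio : InjOn γ (Ioo c d) := fun x hx y hy => hinjo x (Ioo_subset_Icc_self hx) y hy
    exact (Ioo_infinite hcd) (hfin.of_finite_image hio)
  set z₀ := γ t₀ with hz₀
  set T' := Polynomial.derivative T with hT'def
  have ht₀' := Ioo_subset_Icc_self ht₀
  set x₀ : ℝ := (T.eval z₀).re with hx₀
  have hx₀e : T.eval z₀ = x₀ := Complex.ext rfl (by simpa using him t₀ ht₀')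
  obtain ⟨D, hD⟩ : (Polynomial.X - Polynomial.C z₀) ∣ T - Polynomial.C (x₀ : ℂ) :=
    Polynomial.dvd_iff_isRoot.2 (by simp [hx₀e])
  have hDe : ∀ z, T.eval z - x₀ = (z - z₀) * D.eval z := fun z => by
    simpa using congrArg (Polynomial.eval z) hD
  have hDz : D.eval z₀ = T'.eval z₀ := by
    have := congrArg (fun p => (Polynomial.derivative p).eval z₀) hD
    simpa using this.symm
  have hDz0 : D.eval z₀ ≠ 0 := by rwa [hDz]
  have hγc := hγ.continuousOn
  have hγ'c : ContinuousOn (deriv γ) (Icc c d) := hγ.deriv.continuousOn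
  set u : ℝ → ℝ := fun t => (T.eval (γ t)).re with hu
  have huT : ∀ t ∈ Icc c d, T.eval (γ t) = u t := fun t ht =>
    Complex.ext rfl (by simpa using him t ht)
  have huc : ContinuousOn u (Icc c d) :=
    Complex.continuous_re.comp_continuousOn (T.continuous.comp_continuousOn hγc)
  obtain ⟨R', hR'⟩ := isCompact_Icc.exists_bound_of_continuousOn (huc.sub (continuousOn_const (c := x₀)))
  set R := max R' 1 with hR
  have hR0 : 0 < R := lt_of_lt_of_le one_pos (le_max_right _ _)
  have huR : ∀ t ∈ Icc c d, |u t - x₀| ≤ R := fun t ht => (hR' t ht).trans (le_max_left _ _)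
  set κ : ℂ := (D.eval z₀ ^ 2 * (T'.eval z₀ * deriv γ t₀))⁻¹ with hκ
  set G : ℝ → ℂ := fun t => T'.eval (γ t) * deriv γ t * κ with hG
  -- The kernel peaks wherever `T = x₀` on the loop, perhaps not only at `t₀`. The factor `D ^ 2`
  -- removes the other peaks: away from `t₀` it equals `(u - x₀) ^ 2 / (γ - z₀) ^ 2`, which is
  -- dominated by `v`. The constant `κ` normalises `H t₀` to `1`.
  set H : ℝ → ℂ := fun t => D.eval (γ t) ^ 2 * G t with hH
  have hGc : ContinuousOn G (Icc c d) :=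
    ((T'.continuous.comp_continuousOn hγc).mul hγ'c).mul continuousOn_const
  have hHc : ContinuousOn H (Icc c d) := ((D.continuous.comp_continuousOn hγc).pow 2).mul hGc
  have hH1 : H t₀ = 1 := by
    have h1 := h0 t₀ ht₀'
    simp only [hH, hG, hκ]
    rw [← hz₀]
    field_simp
  set v : ℝ → ℝ := fun t => ((u t - x₀) / R) ^ 2 with hv
  have hvc : ContinuousOn v (Icc c d) := ((huc.sub continuousOn_const).div_const R).pow 2
  have hzero : ∀ k : ℕ, ∫ t in c..d, (H t).re * (1 - v t) ^ k = 0 := by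
    intro k
    set q : Polynomial ℂ := D ^ 2 * T' * Polynomial.C κ *
      (1 - (Polynomial.C ((R : ℂ)⁻¹) * (T - Polynomial.C (x₀ : ℂ))) ^ 2) ^ k with hq
    have h1 := integral_polynomial_closed_curve q hcd.le hγ hcl
    have h2 : ∀ t ∈ uIcc c d, q.eval (γ t) * deriv γ t = H t * ((1 - v t : ℝ) : ℂ) ^ k := by
      intro t ht
      rw [uIcc_of_le hcd.le] at ht
      simp only [hq, hH, hG, hv, Polynomial.eval_mul, Polynomial.eval_pow, Polynomial.eval_sub,
        Polynomial.eval_one, Polynomial.eval_C, huT t ht]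
      push_cast
      rw [div_eq_inv_mul]
      ring
    rw [intervalIntegral.integral_congr h2] at h1
    have hi : IntervalIntegrable (fun t => H t * ((1 - v t : ℝ) : ℂ) ^ k) MeasureTheory.volume c d := by
      refine ContinuousOn.intervalIntegrable ?_
      rw [uIcc_of_le hcd.le]
      exact hHc.mul ((Complex.continuous_ofReal.comp_continuousOn
        (continuousOn_const.sub hvc)).pow k)
    have h3 := Complex.reCLM.intervalIntegral_comp_comm hi
    rw [h1] at h3
    simp only [map_zero] at h3
    rw [← h3]
    refine intervalIntegral.integral_congr fun t _ => ?_
    simp only [Complex.reCLM_apply]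
    rw [← Complex.ofReal_pow, Complex.re_mul_ofReal]
  have hud : DifferentiableAt ℝ u t₀ := by
    have h1 : DifferentiableAt ℝ (fun t => T.eval (γ t)) t₀ :=
      (T.differentiable.differentiableAt.restrictScalars ℝ).comp t₀ (hγ t₀ ht₀').differentiableAt
    exact Complex.reCLM.differentiableAt.comp t₀ h1
  obtain ⟨M', hM'0, hM'⟩ := hud.isBigO_sub.exists_pos
  have hev : ∀ᶠ t in 𝓝 t₀, t ∈ Ioo c d ∧ 1 / 2 ≤ (H t).re ∧ |u t - x₀| ≤ M' * |t - t₀| := by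
    have hHat : ContinuousAt (fun t => (H t).re) t₀ :=
      Complex.continuous_re.continuousAt.comp (hHc.continuousAt (Icc_mem_nhds ht₀.1 ht₀.2))
    have h1 : (1 / 2 : ℝ) < (H t₀).re := by rw [hH1]; norm_num
    exact (show ∀ᶠ t in 𝓝 t₀, t ∈ Ioo c d from Ioo_mem_nhds ht₀.1 ht₀.2).and ((hHat.eventually (lt_mem_nhds h1)).mono
      (fun t ht => le_of_lt ht) |>.and hM'.bound)
  obtain ⟨η, hη, hηN⟩ := Metric.nhds_basis_closedBall.eventually_iff.1 hev
  simp only [Real.closedBall_eq_Icc] at hηN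
  have hηa : c ≤ t₀ - η := (hηN ⟨le_rfl, by linarith⟩).1.1.le
  have hηb : t₀ + η ≤ d := (hηN ⟨by linarith, le_rfl⟩).1.2.le
  obtain ⟨C, hC⟩ : ∃ C, ∀ t ∈ Icc c d \ Ioo (t₀ - η) (t₀ + η), ‖G t / (γ t - z₀) ^ 2‖ ≤ C := by
    refine IsCompact.exists_bound_of_continuousOn (isCompact_Icc.diff isOpen_Ioo) ?_
    refine (hGc.mono sdiff_subset).div (((hγc.mono sdiff_subset).sub continuousOn_const).pow 2) ?_
    intro t ht
    refine pow_ne_zero 2 (sub_ne_zero.2 fun he => ?_)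
    have := hinjo t ht.1 t₀ ht₀ he
    subst this
    exact ht.2 ⟨by linarith, by linarith⟩
  have hbound : ∀ t ∈ Icc c d, t ∉ Icc (t₀ - η) (t₀ + η) →
      |(H t).re| ≤ (max C 0 * R ^ 2) * v t := by
    intro t ht htN
    have htK : t ∈ Icc c d \ Ioo (t₀ - η) (t₀ + η) :=
      ⟨ht, fun h => htN (Ioo_subset_Icc_self h)⟩
    have hne : γ t - z₀ ≠ 0 := by
      refine sub_ne_zero.2 fun he => ?_
      have := hinjo t ht t₀ ht₀ he
      subst this
      exact htN ⟨by linarith, by linarith⟩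
    have h1 : H t = ((u t - x₀ : ℝ) : ℂ) ^ 2 * (G t / (γ t - z₀) ^ 2) := by
      have := hDe (γ t)
      rw [huT t ht] at this
      simp only [hH]
      push_cast
      rw [this]
      field_simp
    calc |(H t).re| ≤ ‖H t‖ := Complex.abs_re_le_norm _
      _ = (u t - x₀) ^ 2 * ‖G t / (γ t - z₀) ^ 2‖ := by
        rw [h1, norm_mul, norm_pow, Complex.norm_real, Real.norm_eq_abs, sq_abs]
      _ ≤ (u t - x₀) ^ 2 * max C 0 := by
        gcongr
        exact (hC t htK).trans (le_max_left _ _)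
      _ = (max C 0 * R ^ 2) * v t := by
        simp only [hv]
        field_simp
  obtain ⟨k, hk⟩ := exists_integral_peak_ne_zero (a := c) (b := d) (t₀ := t₀) (η := η)
    (M := M' / R) (C := max C 0 * R ^ 2) (h := fun t => (H t).re) (v := v) hη hηa hηb
    (by positivity) (Complex.continuous_re.comp_continuousOn hHc) hvc
    (fun t _ => sq_nonneg _)
    (fun t ht => by
      simp only [hv]
      rw [sq_le_one_iff_abs_le_one, abs_div, abs_of_pos hR0]
      exact (div_le_one hR0).2 (huR t ht))
    (fun t ht => by
      have h1 := (hηN ht).2.2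
      simp only [hv]
      rw [div_mul_eq_mul_div, div_pow, div_pow]
      refine div_le_div_of_nonneg_right (sq_le_sq.2 ?_) (sq_nonneg R)
      rwa [abs_mul, abs_of_pos hM'0])
    (fun t ht => (hηN ht).2.1) (by positivity) hbound
  exact hk (hzero k)

/-! ### Straightness in the local coordinate -/

/-- The power map commutes with conjugation and is injective near `1`, so a point with real `m`-th
power there equals its conjugate. -/
theorem eventually_im_eq_zero_of_im_pow {m : ℕ} (hm : 0 < m) :
    ∀ᶠ z in 𝓝 (1 : ℂ), (z ^ m).im = 0 → z.im = 0 := by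
  have hd : HasStrictDerivAt (fun z : ℂ => z ^ m) (m * 1 ^ (m - 1)) 1 := hasStrictDerivAt_pow m 1
  have hne : (m : ℂ) * 1 ^ (m - 1) ≠ 0 := by simpa using hm.ne'
  have h1 := hd.eventually_left_inverse hne
  have hconj : Tendsto (starRingEnd ℂ) (𝓝 1) (𝓝 1) := by
    have := (Complex.continuous_conj).tendsto 1
    rwa [map_one] at this
  filter_upwards [h1, hconj.eventually h1] with z hz hz' him
  rw [← Complex.conj_eq_iff_im] at him ⊢
  rw [← map_pow, him, hz] at hz'
  exact hz'.symm

theorem tendsto_slope_of_zero {g : ℝ → ℂ} {w : ℂ} {t : ℝ} (hg : HasDerivAt g w t) (h0 : g t = 0) :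
    Tendsto (fun s => g s / ((s - t : ℝ) : ℂ)) (𝓝[≠] t) (𝓝 w) := by
  have := hasDerivAt_iff_tendsto_slope.1 hg
  refine this.congr fun s => ?_
  rw [slope_def_module, h0, sub_zero, Complex.real_smul, Complex.ofReal_inv, div_eq_inv_mul]

theorem eventually_eq_of_hasDerivAt_zero {f : ℝ → ℝ} {t : ℝ}
    (hf : ∀ᶠ s in 𝓝 t, HasDerivAt f 0 s) : ∀ᶠ s in 𝓝 t, f s = f t := by
  obtain ⟨r, hr, h⟩ := Metric.eventually_nhds_iff_ball.1 hf
  filter_upwards [Metric.ball_mem_nhds t hr] with y hy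
  exact Metric.isOpen_ball.is_const_of_deriv_eq_zero (convex_ball t r).isPreconnected
    (fun z hz => (h z hz).differentiableAt.differentiableWithinAt)
    (fun z hz => (h z hz).deriv) hy (Metric.mem_ball_self hr)

namespace IsNormalForm

variable {T : Polynomial ℂ} {z₀ : ℂ} {m : ℕ} {φ ψ : ℂ → ℂ}

theorem hasDerivAt_comp (N : IsNormalForm T z₀ m φ ψ) {γ : ℝ → ℂ} {t : ℝ}
    (hγ : DifferentiableAt ℝ γ t) (hz : γ t = z₀) :
    HasDerivAt (fun s => φ (γ s)) (deriv φ z₀ * deriv γ t) t :=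
  N.analytic.differentiableAt.hasDerivAt.comp_of_eq t hγ.hasDerivAt hz.symm

theorem eventually_eval_comp (N : IsNormalForm T z₀ m φ ψ) {γ : ℝ → ℂ} {t : ℝ}
    (hγ : ContinuousAt γ t) (hz : γ t = z₀) :
    ∀ᶠ s in 𝓝 t, φ (γ s) ^ m = T.eval (γ s) - T.eval z₀ := by
  have h : Tendsto γ (𝓝 t) (𝓝 z₀) := by rw [← hz]; exact hγ
  filter_upwards [h.eventually N.eval_eq] with s hs
  rw [hs]; ring

theorem tendsto_div_pow (N : IsNormalForm T z₀ m φ ψ) {γ : ℝ → ℂ} {t : ℝ}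
    (hγ : DifferentiableAt ℝ γ t) (hz : γ t = z₀) :
    Tendsto (fun s => (T.eval (γ s) - T.eval z₀) / (((s - t) ^ m : ℝ) : ℂ)) (𝓝[≠] t)
      (𝓝 ((deriv φ z₀ * deriv γ t) ^ m)) := by
  have h1 := (tendsto_slope_of_zero (N.hasDerivAt_comp hγ hz) (by simp [hz, N.apply_base])).pow m
  refine h1.congr' ?_
  filter_upwards [nhdsWithin_le_nhds (N.eventually_eval_comp hγ.continuousAt hz)] with s hs
  rw [div_pow, hs]; push_cast; rfl

/-- A curve on which `T` is real is a straight line in the coordinate `φ`. -/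
theorem eventually_im_div_eq_zero (N : IsNormalForm T z₀ m φ ψ) {γ : ℝ → ℂ} {t : ℝ}
    (hγ : DifferentiableAt ℝ γ t) (hz : γ t = z₀) (h0 : deriv γ t ≠ 0)
    (him : ∀ᶠ s in 𝓝 t, (T.eval (γ s)).im = 0) :
    ∀ᶠ s in 𝓝 t, (φ (γ s) / (deriv φ z₀ * deriv γ t)).im = 0 := by
  set w := deriv φ z₀ * deriv γ t with hw
  have hw0 : w ≠ 0 := mul_ne_zero N.deriv_ne h0
  have him0 : (T.eval z₀).im = 0 := hz ▸ him.self_of_nhds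
  have hdiff : ∀ᶠ s in 𝓝 t, (T.eval (γ s) - T.eval z₀).im = 0 := by
    filter_upwards [him] with s hs
    simp [hs, him0]
  -- `w ^ m` is the limit of the real quotients `(T (γ s) - T z₀) / (s - t) ^ m`. Hence `φ (γ s) /
  -- ((s - t) * w)` has a real `m`-th power, and it tends to `1`.
  have hwim : (w ^ m).im = 0 := by
    have h1 := Complex.continuous_im.continuousAt.tendsto.comp (N.tendsto_div_pow hγ hz)
    refine tendsto_nhds_unique h1 (tendsto_const_nhds.congr' ?_)
    filter_upwards [nhdsWithin_le_nhds hdiff] with s hs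
    simp only [Function.comp_apply]
    rw [Complex.div_ofReal_im, hs, zero_div]
  have hq : Tendsto (fun s => φ (γ s) / ((s - t : ℝ) : ℂ) / w) (𝓝[≠] t) (𝓝 1) := by
    have := (tendsto_slope_of_zero (N.hasDerivAt_comp hγ hz) (by simp [hz, N.apply_base])).div_const w
    rwa [← hw, div_self hw0] at this
  have hev := hq.eventually (eventually_im_eq_zero_of_im_pow N.pos)
  have hmain : ∀ᶠ s in 𝓝[≠] t, (φ (γ s) / w).im = 0 := by
    filter_upwards [hev, nhdsWithin_le_nhds hdiff,
      nhdsWithin_le_nhds (N.eventually_eval_comp hγ.continuousAt hz),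
      self_mem_nhdsWithin] with s h1 h2 h3 h4
    have hst : (s - t : ℝ) ≠ 0 := sub_ne_zero.2 h4
    have h5 : (φ (γ s) / ((s - t : ℝ) : ℂ) / w).im = 0 := by
      apply h1
      have hwr : w ^ m = ((w ^ m).re : ℂ) := Complex.ext rfl (by simpa using hwim)
      rw [div_pow, div_pow, h3, hwr, ← Complex.ofReal_pow, Complex.div_ofReal_im,
        Complex.div_ofReal_im, h2]
      simp
    have h6 : φ (γ s) / ((s - t : ℝ) : ℂ) / w = φ (γ s) / w / ((s - t : ℝ) : ℂ) := by
      rw [div_right_comm]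
    rw [h6, Complex.div_ofReal_im, div_eq_zero_iff] at h5
    exact h5.resolve_right hst
  rw [eventually_nhdsWithin_iff] at hmain
  filter_upwards [hmain] with s hs
  by_cases hst : s = t
  · rw [hst, hz, N.apply_base]; simp
  · exact hs hst

/-- The real function is `φ ∘ γ / w`. All such curves with tangent direction `w` therefore trace the
same line through `ψ` and differ only by a real reparametrisation. -/
theorem exists_real_coordinate (N : IsNormalForm T z₀ m φ ψ) {γ : ℝ → ℂ} {t : ℝ}
    (hγ : AnalyticAt ℝ γ t) (hz : γ t = z₀) (h0 : deriv γ t ≠ 0)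
    (him : ∀ᶠ s in 𝓝 t, (T.eval (γ s)).im = 0) :
    ∃ x : ℝ → ℝ, AnalyticAt ℝ x t ∧ x t = 0 ∧ HasDerivAt x 1 t ∧
      ∀ᶠ s in 𝓝 t, γ s = ψ (deriv φ z₀ * deriv γ t * x s) := by
  have hev := N.eventually_im_div_eq_zero hγ.differentiableAt hz h0 him
  have hd := N.hasDerivAt_comp hγ.differentiableAt hz
  set w := deriv φ z₀ * deriv γ t with hw
  have hw0 : w ≠ 0 := mul_ne_zero N.deriv_ne h0
  have hf : AnalyticAt ℝ (fun s => φ (γ s) / w) t := by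
    have h1 : AnalyticAt ℝ φ (γ t) := by rw [hz]; exact N.analytic.restrictScalars
    exact (h1.comp hγ).div_const
  refine ⟨fun s => (φ (γ s) / w).re, (Complex.reCLM.analyticAt _).comp hf,
    by simp [hz, N.apply_base], ?_, ?_⟩
  · have h1 := hd.div_const w
    rw [div_self hw0] at h1
    have h2 := Complex.reCLM.hasFDerivAt.comp_hasDerivAt t h1
    simp only [Complex.reCLM_apply, Complex.one_re] at h2
    exact h2
  · have hl : ∀ᶠ s in 𝓝 t, ψ (φ (γ s)) = γ s := by
      have h : Tendsto γ (𝓝 t) (𝓝 z₀) := by rw [← hz]; exact hγ.continuousAt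
      exact h.eventually N.left_inv
    filter_upwards [hl, hev] with s h1 h2
    have h3 : φ (γ s) / w = ((φ (γ s) / w).re : ℂ) := Complex.ext rfl (by simpa using h2)
    rw [← h3, mul_div_cancel₀ _ hw0, h1]

end IsNormalForm

/-! ### Uniqueness of germs and gluing of arcs -/

/-- Two unit speed curves through the same point with the same tangent, on which a nonconstant
polynomial is real, coincide near that point. -/
theorem eventually_eq_of_unitSpeed {T : Polynomial ℂ} (hT : 0 < T.natDegree) {γ η : ℝ → ℂ}
    (hγ : AnalyticAt ℝ γ 0) (hη : AnalyticAt ℝ η 0)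
    (hγs : ∀ᶠ t in 𝓝 0, ‖deriv γ t‖ = 1) (hηs : ∀ᶠ t in 𝓝 0, ‖deriv η t‖ = 1)
    (hγT : ∀ᶠ t in 𝓝 0, (T.eval (γ t)).im = 0) (hηT : ∀ᶠ t in 𝓝 0, (T.eval (η t)).im = 0)
    (h0 : γ 0 = η 0) (hd : deriv γ 0 = deriv η 0) : γ =ᶠ[𝓝 0] η := by
  obtain ⟨m, φ, ψ, N⟩ := exists_isNormalForm hT (γ 0)
  have hγ0 : deriv γ 0 ≠ 0 := norm_ne_zero_iff.1 (by rw [hγs.self_of_nhds]; exact one_ne_zero)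
  obtain ⟨x, hx, hx0, hxd, hxe⟩ := N.exists_real_coordinate hγ rfl hγ0 hγT
  obtain ⟨y, hy, hy0, hyd, hye⟩ := N.exists_real_coordinate hη h0.symm (hd ▸ hγ0) hηT
  have hy' : deriv y 0 ≠ 0 := by rw [hyd.deriv]; exact one_ne_zero
  have hyst := hy.hasStrictDerivAt
  set Y := hyst.localInverse _ _ _ hy' with hY
  have hYan : AnalyticAt ℝ Y 0 := by
    have := hy.analyticAt_localInverse hy'
    rwa [hy0] at this
  have hY0 : Y 0 = 0 := by
    have : Y (y 0) = 0 := (hyst.eventually_left_inverse hy').self_of_nhds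
    rwa [hy0] at this
  have hYd : HasDerivAt Y 1 0 := by
    have h1 : HasDerivAt Y (deriv y 0)⁻¹ (y 0) := (hyst.to_localInverse hy').hasDerivAt
    rwa [hy0, show (deriv y 0)⁻¹ = 1 by rw [hyd.deriv, inv_one]] at h1
  have hYr : ∀ᶠ s in 𝓝 0, y (Y s) = s := by
    have := hyst.eventually_right_inverse hy'
    rwa [hy0] at this
  set σ : ℝ → ℝ := fun t => Y (x t) with hσ
  have hσan : AnalyticAt ℝ σ 0 := by
    refine AnalyticAt.fun_comp (f := x) (g := Y) ?_ hx
    rwa [hx0]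
  have hσ0 : σ 0 = 0 := by simp [hσ, hx0, hY0]
  have hσd : HasDerivAt σ 1 0 := by
    have := hYd.comp_of_eq 0 hxd hx0.symm
    rwa [one_mul] at this
  have hσt : Tendsto σ (𝓝 0) (𝓝 0) := by
    have := hσan.continuousAt.tendsto
    rwa [hσ0] at this
  have hxt : Tendsto x (𝓝 0) (𝓝 0) := by
    have := hx.continuousAt.tendsto
    rwa [hx0] at this
  have hcomp : ∀ᶠ t in 𝓝 0, γ t = η (σ t) := by
    filter_upwards [hxe, hσt.eventually hye, hxt.eventually hYr] with t h1 h2 h3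
    rw [h1, h2, hd]
    simp only [hσ, h3]
  -- Both curves have unit speed, so the change of parameter has derivative of absolute value `1`;
  -- it is positive because it is `1` at `0`.
  have hσ1 : ∀ᶠ t in 𝓝 0, deriv σ t = 1 := by
    have hpos : ∀ᶠ t in 𝓝 0, 0 < deriv σ t :=
      hσan.deriv.continuousAt.eventually (by rw [hσd.deriv]; exact lt_mem_nhds one_pos)
    filter_upwards [hpos, hcomp.eventually_nhds, hγs, hσt.eventually hηs,
      hσt.eventually hη.eventually_analyticAt, hσan.eventually_analyticAt] with t h1 h2 h3 h4 h5 h6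
    have h7 : HasDerivAt (fun s => η (σ s)) (deriv σ t • deriv η (σ t)) t :=
      h5.differentiableAt.hasDerivAt.scomp t h6.differentiableAt.hasDerivAt
    have h8 : deriv γ t = deriv σ t • deriv η (σ t) := by
      rw [← h7.deriv]; exact EventuallyEq.deriv_eq h2
    rw [h8, norm_smul, h4, mul_one, Real.norm_eq_abs, abs_of_pos h1] at h3
    exact h3
  have hconst := eventually_eq_of_hasDerivAt_zero (f := fun t => σ t - t) (t := 0) (by
    filter_upwards [hσ1, hσan.eventually_analyticAt] with t h1 h2
    have := h2.differentiableAt.hasDerivAt.fun_sub (hasDerivAt_id' t)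
    rwa [h1, sub_self] at this)
  filter_upwards [hcomp, hconst] with t h1 h2
  rw [hσ0, sub_zero, sub_eq_zero] at h2
  rw [h1, h2]

/-- This lets identities between analytic functions spread from a closed interval to a full
neighbourhood of each of its points, the endpoints included. -/
theorem frequently_mem_Icc {a b t : ℝ} (hab : a < b) (ht : t ∈ Icc a b) :
    ∃ᶠ s in 𝓝[≠] t, s ∈ Icc a b := by
  rcases lt_or_eq_of_le ht.2 with h | h
  · refine Frequently.filter_mono (f := 𝓝[>] t) ?_ (nhdsWithin_mono _ fun s hs => ne_of_gt hs)
    exact Eventually.frequently (mem_of_superset (Ioo_mem_nhdsGT h)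
      fun s hs => ⟨ht.1.trans hs.1.le, hs.2.le⟩)
  · refine Frequently.filter_mono (f := 𝓝[<] t) ?_ (nhdsWithin_mono _ fun s hs => ne_of_lt hs)
    exact Eventually.frequently (mem_of_superset (Ioo_mem_nhdsLT (h ▸ hab))
      fun s hs => ⟨hs.1.le, hs.2.le.trans ht.2⟩)

theorem AnalyticAt.eventuallyEq_of_eqOn_Icc {E : Type*} [NormedAddCommGroup E] [NormedSpace ℝ E]
    {f g : ℝ → E} {a b t : ℝ} (hab : a < b) (ht : t ∈ Icc a b) (hf : AnalyticAt ℝ f t)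
    (hg : AnalyticAt ℝ g t) (h : EqOn f g (Icc a b)) : f =ᶠ[𝓝 t] g :=
  (hf.frequently_eq_iff_eventually_eq hg).1 ((frequently_mem_Icc hab ht).mono fun _ hs => h hs)

theorem Polynomial.analyticAt_im_eval_comp (T : Polynomial ℂ) {γ : ℝ → ℂ} {t : ℝ}
    (hγ : AnalyticAt ℝ γ t) : AnalyticAt ℝ (fun s => (T.eval (γ s)).im) t := by
  have h1 : AnalyticAt ℝ (fun z => T.eval z) (γ t) :=
    (T.differentiable.analyticAt (γ t)).restrictScalars
  exact (Complex.imCLM.analyticAt _).comp (h1.comp hγ)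

theorem IsUnitSpeed.eventually_speed {σ : ℝ → ℂ} {a b t : ℝ} (hσ : IsUnitSpeed σ a b) (hab : a < b)
    (ht : t ∈ Icc a b) : ∀ᶠ s in 𝓝 t, ‖deriv σ s‖ = 1 := by
  have h0 : deriv σ t ≠ 0 := norm_ne_zero_iff.1 (by rw [hσ.speed t ht]; exact one_ne_zero)
  exact ((hσ.analytic t ht).deriv.norm_complex h0).eventuallyEq_of_eqOn_Icc hab ht
    (g := fun _ => 1) analyticAt_const hσ.speed

theorem eventually_im_eval_eq_zero (T : Polynomial ℂ) {γ : ℝ → ℂ} {a b t : ℝ} (hab : a < b)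
    (ht : t ∈ Icc a b) (hγ : AnalyticAt ℝ γ t) (him : ∀ s ∈ Icc a b, (T.eval (γ s)).im = 0) :
    ∀ᶠ s in 𝓝 t, (T.eval (γ s)).im = 0 :=
  (T.analyticAt_im_eval_comp hγ).eventuallyEq_of_eqOn_Icc hab ht (g := fun _ => 0)
    analyticAt_const him

theorem IsUnitSpeed.comp_affine {σ : ℝ → ℂ} {a b a' b' s ε : ℝ} (hσ : IsUnitSpeed σ a b)
    (hε : |ε| = 1) (hmaps : ∀ t ∈ Icc a' b', s + ε * t ∈ Icc a b) :
    IsUnitSpeed (fun t => σ (s + ε * t)) a' b' where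
  analytic t ht := by
    refine AnalyticAt.fun_comp (f := fun t => s + ε * t) (hσ.analytic _ (hmaps t ht)) ?_
    fun_prop
  speed t ht := by
    have h1 : HasDerivAt (fun t : ℝ => s + ε * t) ε t := by
      simpa using ((hasDerivAt_id' t).const_mul ε).const_add s
    have h2 := (hσ.analytic _ (hmaps t ht)).differentiableAt.hasDerivAt.scomp t h1
    have h3 : deriv (fun t => σ (s + ε * t)) t = ε • deriv σ (s + ε * t) := h2.deriv
    rw [h3, norm_smul, hσ.speed _ (hmaps t ht), Real.norm_eq_abs, hε, one_mul]

/-- Injectivity is not assumed: it comes from `injOn_of_im_eval_eq_zero`, and so a glued curve is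
automatically a Jordan arc. -/
theorem IsUnitSpeed.isAnalyticJordanArc {T : Polynomial ℂ} (hT : 0 < T.natDegree) {σ : ℝ → ℂ}
    {a b : ℝ} (hab : a < b) (hσ : IsUnitSpeed σ a b)
    (him : ∀ s ∈ Icc a b, (T.eval (σ s)).im = 0) : IsAnalyticJordanArc (σ '' Icc a b) := by
  have h0 : ∀ t ∈ Icc a b, deriv σ t ≠ 0 := fun t ht =>
    norm_ne_zero_iff.1 (by rw [hσ.speed t ht]; exact one_ne_zero)
  have hinj := injOn_of_im_eval_eq_zero hT hσ.analytic h0 him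
  have hba : 0 < b - a := sub_pos.2 hab
  have hmaps : ∀ t ∈ Icc (0 : ℝ) 1, a + (b - a) * t ∈ Icc a b := fun t ht =>
    ⟨by nlinarith [ht.1], by nlinarith [ht.2]⟩
  refine ⟨fun t => σ (a + (b - a) * t), ⟨?_, ?_, ?_⟩, ?_⟩
  · intro t ht
    refine AnalyticAt.fun_comp (f := fun t => a + (b - a) * t) (hσ.analytic _ (hmaps t ht)) ?_
    fun_prop
  · intro s hs t ht hst
    have := hinj (hmaps s hs) (hmaps t ht) hst
    exact mul_left_cancel₀ hba.ne' (add_left_cancel this)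
  · intro t ht
    have h1 : HasDerivAt (fun t : ℝ => a + (b - a) * t) (b - a) t := by
      simpa using ((hasDerivAt_id' t).const_mul (b - a)).const_add a
    have h2 := (hσ.analytic _ (hmaps t ht)).differentiableAt.hasDerivAt.scomp t h1
    have h3 : deriv (fun t => σ (a + (b - a) * t)) t = (b - a) • deriv σ (a + (b - a) * t) := h2.deriv
    rw [h3]
    exact smul_ne_zero hba.ne' (h0 _ (hmaps t ht))
  · ext z
    constructor
    · rintro ⟨t, ht, rfl⟩
      exact ⟨_, hmaps t ht, rfl⟩
    · rintro ⟨s, hs, rfl⟩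
      refine ⟨(s - a) / (b - a), ⟨div_nonneg (by linarith [hs.1]) hba.le,
        (div_le_one hba).2 (by linarith [hs.2])⟩, ?_⟩
      simp only
      rw [mul_div_cancel₀ _ hba.ne', add_sub_cancel]

/-- Two unit speed curves that agree to first order at the parameter `0` are restrictions of one
unit speed curve. -/
theorem IsUnitSpeed.glue {T : Polynomial ℂ} (hT : 0 < T.natDegree) {γ₁ γ₂ : ℝ → ℂ}
    {a₁ b₁ a₂ b₂ : ℝ} (h₁ : IsUnitSpeed γ₁ a₁ b₁) (h₂ : IsUnitSpeed γ₂ a₂ b₂)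
    (hab₁ : a₁ < b₁) (hab₂ : a₂ < b₂) (h0₁ : 0 ∈ Icc a₁ b₁) (h0₂ : 0 ∈ Icc a₂ b₂)
    (him₁ : ∀ s ∈ Icc a₁ b₁, (T.eval (γ₁ s)).im = 0)
    (him₂ : ∀ s ∈ Icc a₂ b₂, (T.eval (γ₂ s)).im = 0)
    (h0 : γ₁ 0 = γ₂ 0) (hd : deriv γ₁ 0 = deriv γ₂ 0) :
    IsAnalyticJordanArc (γ₁ '' Icc a₁ b₁ ∪ γ₂ '' Icc a₂ b₂) := by
  have hgerm := eventually_eq_of_unitSpeed hT (h₁.analytic 0 h0₁) (h₂.analytic 0 h0₂)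
    (h₁.eventually_speed hab₁ h0₁) (h₂.eventually_speed hab₂ h0₂)
    (eventually_im_eval_eq_zero T hab₁ h0₁ (h₁.analytic 0 h0₁) him₁)
    (eventually_im_eval_eq_zero T hab₂ h0₂ (h₂.analytic 0 h0₂) him₂) h0 hd
  obtain ⟨δ₁, hδ₁, hU₁⟩ := exists_Icc_subset_of_isOpen hab₁.le (isOpen_analyticAt ℝ γ₁) h₁.analytic
  obtain ⟨δ₂, hδ₂, hU₂⟩ := exists_Icc_subset_of_isOpen hab₂.le (isOpen_analyticAt ℝ γ₂) h₂.analytic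
  -- The closed intervals may share only the point `0`. On open enlargements the overlap is an
  -- interval around `0`, and the identity theorem extends the equality of germs to all of it.
  set I₁ := Ioo (a₁ - δ₁) (b₁ + δ₁) with hI₁
  set I₂ := Ioo (a₂ - δ₂) (b₂ + δ₂) with hI₂
  have hsub₁ : Icc a₁ b₁ ⊆ I₁ := fun t ht => ⟨by linarith [ht.1], by linarith [ht.2]⟩
  have hsub₂ : Icc a₂ b₂ ⊆ I₂ := fun t ht => ⟨by linarith [ht.1], by linarith [ht.2]⟩
  have heq : EqOn γ₁ γ₂ (I₁ ∩ I₂) := by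
    refine AnalyticOnNhd.eqOn_of_preconnected_of_eventuallyEq (𝕜 := ℝ) (z₀ := 0)
      (fun t ht => hU₁ (Ioo_subset_Icc_self ht.1)) (fun t ht => hU₂ (Ioo_subset_Icc_self ht.2)) ?_
      ⟨hsub₁ h0₁, hsub₂ h0₂⟩ hgerm
    rw [hI₁, hI₂, Ioo_inter_Ioo]
    exact isPreconnected_Ioo
  classical
  set γ : ℝ → ℂ := fun t => if t ∈ I₁ then γ₁ t else γ₂ t with hγ
  have hγ₁ : EqOn γ γ₁ I₁ := fun t ht => by simp only [hγ, if_pos ht]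
  have hγ₂ : EqOn γ γ₂ I₂ := fun t ht => by
    by_cases h : t ∈ I₁
    · rw [hγ₁ h, heq ⟨h, ht⟩]
    · simp only [hγ, if_neg h]
  have hev₁ : ∀ t ∈ Icc a₁ b₁, γ =ᶠ[𝓝 t] γ₁ := fun t ht =>
    hγ₁.eventuallyEq_of_mem (isOpen_Ioo.mem_nhds (hsub₁ ht))
  have hev₂ : ∀ t ∈ Icc a₂ b₂, γ =ᶠ[𝓝 t] γ₂ := fun t ht =>
    hγ₂.eventuallyEq_of_mem (isOpen_Ioo.mem_nhds (hsub₂ ht))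
  have hunion : Icc (min a₁ a₂) (max b₁ b₂) = Icc a₁ b₁ ∪ Icc a₂ b₂ :=
    (Icc_union_Icc' (h0₂.1.trans h0₁.2) (h0₁.1.trans h0₂.2)).symm
  have hu : IsUnitSpeed γ (min a₁ a₂) (max b₁ b₂) := by
    constructor
    · rw [hunion]
      rintro t (ht | ht)
      · exact (h₁.analytic t ht).congr (hev₁ t ht).symm
      · exact (h₂.analytic t ht).congr (hev₂ t ht).symm
    · rw [hunion]
      rintro t (ht | ht)
      · rw [(hev₁ t ht).deriv_eq, h₁.speed t ht]
      · rw [(hev₂ t ht).deriv_eq, h₂.speed t ht]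
  have harc := hu.isAnalyticJordanArc hT
    (lt_of_le_of_lt (min_le_left _ _) (hab₁.trans_le (le_max_left _ _))) (by
      rw [hunion]
      rintro t (ht | ht)
      · rw [hγ₁ (hsub₁ ht)]; exact him₁ t ht
      · rw [hγ₂ (hsub₂ ht)]; exact him₂ t ht)
  rwa [hunion, image_union, (hγ₁.mono hsub₁).image_eq, (hγ₂.mono hsub₂).image_eq] at harc

theorem image_affine {σ : ℝ → ℂ} {s L : ℝ} :
    (fun t => σ (s + 1 * t)) '' Icc (-s) (L - s) = σ '' Icc 0 L ∧
    (fun t => σ (s + -1 * t)) '' Icc (s - L) s = σ '' Icc 0 L := by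
  constructor <;> ext z <;> constructor
  · rintro ⟨t, ht, rfl⟩
    exact ⟨s + 1 * t, ⟨by linarith [ht.1], by linarith [ht.2]⟩, rfl⟩
  · rintro ⟨t, ht, rfl⟩
    exact ⟨t - s, ⟨by linarith [ht.1], by linarith [ht.2]⟩, by simp⟩
  · rintro ⟨t, ht, rfl⟩
    exact ⟨s + -1 * t, ⟨by linarith [ht.2], by linarith [ht.1]⟩, rfl⟩
  · rintro ⟨t, ht, rfl⟩
    exact ⟨s - t, ⟨by linarith [ht.2], by linarith [ht.1]⟩, by simp⟩

theorem deriv_comp_affine {σ : ℝ → ℂ} {s ε : ℝ} (h : DifferentiableAt ℝ σ s) :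
    deriv (fun t => σ (s + ε * t)) 0 = ε * deriv σ s := by
  have h1 : HasDerivAt (fun t : ℝ => s + ε * t) ε 0 := by
    simpa using ((hasDerivAt_id' (0 : ℝ)).const_mul ε).const_add s
  have h2 := h.hasDerivAt.scomp_of_eq 0 h1 (by simp)
  exact h2.deriv

/-- Two analytic arcs on which a nonconstant polynomial is real, and which have a common point with
parallel tangents, have an analytic Jordan arc as their union. -/
theorem isAnalyticJordanArc_union {T : Polynomial ℂ} (hT : 0 < T.natDegree) {γ₁ γ₂ : ℝ → ℂ}
    (h₁ : IsAnalyticArcParam γ₁) (h₂ : IsAnalyticArcParam γ₂)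
    (him₁ : ∀ z ∈ arcTrace γ₁, (T.eval z).im = 0) (him₂ : ∀ z ∈ arcTrace γ₂, (T.eval z).im = 0)
    {t₁ t₂ : ℝ} (ht₁ : t₁ ∈ Icc (0 : ℝ) 1) (ht₂ : t₂ ∈ Icc (0 : ℝ) 1) (he : γ₁ t₁ = γ₂ t₂)
    {c : ℝ} (hc : deriv γ₂ t₂ = c * deriv γ₁ t₁) :
    IsAnalyticJordanArc (arcTrace γ₁ ∪ arcTrace γ₂) := by
  obtain ⟨L₁, hL₁, σ₁, hσ₁, htr₁, hpt₁⟩ := h₁.exists_isUnitSpeed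
  obtain ⟨L₂, hL₂, σ₂, hσ₂, htr₂, hpt₂⟩ := h₂.exists_isUnitSpeed
  obtain ⟨s₁, hs₁, hse₁, c₁, hc₁, hcd₁⟩ := hpt₁ t₁ ht₁
  obtain ⟨s₂, hs₂, hse₂, c₂, hc₂, hcd₂⟩ := hpt₂ t₂ ht₂
  have h1 : deriv σ₁ s₁ ≠ 0 := norm_ne_zero_iff.1 (by rw [hσ₁.speed s₁ hs₁]; exact one_ne_zero)
  -- Unit tangents that are real multiples of one another differ by a sign. When it is `-1` the
  -- second arc is reversed before gluing.
  obtain ⟨ε, hε⟩ : ∃ ε : ℝ, deriv σ₁ s₁ = ε * deriv σ₂ s₂ := by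
    have hc0 : c ≠ 0 := by
      rintro rfl
      exact h₂.regular t₂ ht₂ (by rw [hc]; simp)
    refine ⟨c₂ / (c * c₁), ?_⟩
    rw [hcd₁, hcd₂] at hc
    have h3 : (c : ℂ) * c₁ ≠ 0 := by exact_mod_cast mul_ne_zero hc0 hc₁
    push_cast
    rw [div_mul_eq_mul_div, hc, eq_div_iff h3]
    ring
  have hεabs : |ε| = 1 := by
    have := congrArg norm hε
    rw [norm_mul, hσ₁.speed s₁ hs₁, hσ₂.speed s₂ hs₂, Complex.norm_real, Real.norm_eq_abs,
      mul_one] at this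
    exact this.symm
  have hi₁ : ∀ s ∈ Icc 0 L₁, (T.eval (σ₁ s)).im = 0 := fun s hs =>
    him₁ _ (htr₁ ▸ mem_image_of_mem _ hs)
  have hi₂ : ∀ s ∈ Icc 0 L₂, (T.eval (σ₂ s)).im = 0 := fun s hs =>
    him₂ _ (htr₂ ▸ mem_image_of_mem _ hs)
  have hm₁ : ∀ t ∈ Icc (-s₁) (L₁ - s₁), s₁ + 1 * t ∈ Icc 0 L₁ := fun t ht =>
    ⟨by linarith [ht.1], by linarith [ht.2]⟩
  have hu₁ : IsUnitSpeed (fun t => σ₁ (s₁ + 1 * t)) (-s₁) (L₁ - s₁) :=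
    hσ₁.comp_affine (by simp) hm₁
  have hdσ₁ := (hσ₁.analytic s₁ hs₁).differentiableAt
  have hdσ₂ := (hσ₂.analytic s₂ hs₂).differentiableAt
  rw [← htr₁, ← htr₂, ← (image_affine (σ := σ₁) (s := s₁)).1]
  rcases (abs_eq zero_le_one).1 hεabs with rfl | rfl
  · have hm₂ : ∀ t ∈ Icc (-s₂) (L₂ - s₂), s₂ + 1 * t ∈ Icc 0 L₂ := fun t ht =>
      ⟨by linarith [ht.1], by linarith [ht.2]⟩
    rw [← (image_affine (σ := σ₂) (s := s₂)).1]
    refine hu₁.glue hT (hσ₂.comp_affine hεabs hm₂) (by linarith) (by linarith)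
      ⟨by linarith [hs₁.1], by linarith [hs₁.2]⟩ ⟨by linarith [hs₂.1], by linarith [hs₂.2]⟩
      (fun t ht => hi₁ _ (hm₁ t ht)) (fun t ht => hi₂ _ (hm₂ t ht)) ?_ ?_
    · simp [hse₁, hse₂, he]
    · rw [deriv_comp_affine hdσ₁, deriv_comp_affine hdσ₂, hε]; simp
  · have hm₂ : ∀ t ∈ Icc (s₂ - L₂) s₂, s₂ + -1 * t ∈ Icc 0 L₂ := fun t ht =>
      ⟨by linarith [ht.2], by linarith [ht.1]⟩
    rw [← (image_affine (σ := σ₂) (s := s₂)).2]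
    refine hu₁.glue hT (hσ₂.comp_affine hεabs hm₂) (by linarith) (by linarith)
      ⟨by linarith [hs₁.1], by linarith [hs₁.2]⟩ ⟨by linarith [hs₂.2], by linarith [hs₂.1]⟩
      (fun t ht => hi₁ _ (hm₁ t ht)) (fun t ht => hi₂ _ (hm₂ t ht)) ?_ ?_
    · simp [hse₁, hse₂, he]
    · rw [deriv_comp_affine hdσ₁, deriv_comp_affine hdσ₂, hε]; simp

/-! ### Rays of the inverse image and tangents of the covering arcs -/

theorem ofReal_re_eq_of_tendsto {α : Type*} {l : Filter α} [l.NeBot] {f : α → ℝ} {w : ℂ}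
    (h : Tendsto (fun x => (f x : ℂ)) l (𝓝 w)) : (w.re : ℂ) = w ∧ Tendsto f l (𝓝 w.re) := by
  have him : w.im = 0 := by
    have h1 := Complex.continuous_im.continuousAt.tendsto.comp h
    refine tendsto_nhds_unique h1 (tendsto_const_nhds.congr fun x => ?_)
    simp
  refine ⟨Complex.ext (by simp) (by simp [him]), ?_⟩
  have h1 := Complex.continuous_re.continuousAt.tendsto.comp h
  exact h1.congr fun x => by simp

theorem tendsto_div_sub_of_tendsto {g : ℝ → ℂ} {w : ℂ} {t : ℝ} {α : Type*} {l : Filter α}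
    {τ : α → ℝ} (hg : HasDerivAt g w t) (h0 : g t = 0) (hτ : Tendsto τ l (𝓝 t))
    (hne : ∀ᶠ x in l, τ x ≠ t) :
    Tendsto (fun x => g (τ x) / ((τ x - t : ℝ) : ℂ)) l (𝓝 w) :=
  (tendsto_slope_of_zero hg h0).comp (tendsto_nhdsWithin_iff.2 ⟨hτ, hne⟩)

/-- Every ray of `S` at `z₀` is covered by one of finitely many arcs through `z₀` tangent to it. -/
theorem IsArcCover.exists_tangent {T : Polynomial ℂ} {z₀ : ℂ} {m : ℕ} {φ ψ : ℂ → ℂ}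
    (N : IsNormalForm T z₀ m φ ψ) {S : Set ℂ} {k : ℕ} {γ : Fin k → ℝ → ℂ} (hγ : IsArcCover S γ)
    {ω : ℂ} (hω : ω ≠ 0) (hray : ∀ᶠ s : ℝ in 𝓝[>] 0, ψ (ω * s) ∈ S) :
    ∃ i, ∃ t ∈ Icc (0 : ℝ) 1, γ i t = z₀ ∧ ∃ ρ : ℝ, ρ ≠ 0 ∧
      deriv φ z₀ * deriv (γ i) t = ρ * ω ∧ (t = 0 → 0 < ρ) ∧ (t = 1 → ρ < 0) := by
  obtain ⟨i, hi⟩ : ∃ i, ∃ᶠ s : ℝ in 𝓝[>] 0, ψ (ω * s) ∈ arcTrace (γ i) := by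
    by_contra! hcon
    have h1 : ∀ i, ∀ᶠ s : ℝ in 𝓝[>] 0, ψ (ω * s) ∉ arcTrace (γ i) := hcon
    obtain ⟨s, hs1, hs2⟩ := (hray.and (eventually_all.2 h1)).exists
    rw [← hγ.union, mem_iUnion] at hs1
    obtain ⟨i, hi⟩ := hs1
    exact hs2 i hi
  set A : Set ℝ := {s | ψ (ω * s) ∈ arcTrace (γ i)} with hA
  have hne : (𝓝[>] (0 : ℝ) ⊓ 𝓟 A).NeBot := frequently_mem_iff_neBot.1 hi
  -- The ultrafilter plays the role of a subsequence: one of the finitely many arcs meets the ray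
  -- arbitrarily close to `z₀`, and by compactness the corresponding parameters converge.
  set U := Ultrafilter.of (𝓝[>] (0 : ℝ) ⊓ 𝓟 A) with hU
  have hUle : (U : Filter ℝ) ≤ 𝓝[>] (0 : ℝ) ⊓ 𝓟 A := Ultrafilter.of_le _
  have hU1 : (U : Filter ℝ) ≤ 𝓝[>] 0 := hUle.trans inf_le_left
  have hU0 : (U : Filter ℝ) ≤ 𝓝 0 := hU1.trans nhdsWithin_le_nhds
  have hUA : ∀ᶠ s in (U : Filter ℝ), s ∈ A := hUle.trans inf_le_right (mem_principal_self A)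
  have hchoice : ∀ s, ∃ τ, s ∈ A → τ ∈ Icc (0 : ℝ) 1 ∧ γ i τ = ψ (ω * s) := fun s => by
    by_cases hs : s ∈ A
    · obtain ⟨τ, h1, h2⟩ := hs
      exact ⟨τ, fun _ => ⟨h1, h2⟩⟩
    · exact ⟨0, fun h => absurd h hs⟩
  choose τ hτ using hchoice
  have hτI : ∀ᶠ s in (U : Filter ℝ), τ s ∈ Icc (0 : ℝ) 1 := hUA.mono fun s hs => (hτ s hs).1
  obtain ⟨t, ht, hUt⟩ := (isCompact_Icc (a := (0 : ℝ)) (b := 1)).ultrafilter_le_nhds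
    (U.map τ) (by rw [le_principal_iff]; exact hτI)
  have hτt : Tendsto τ U (𝓝 t) := hUt
  have hγi := hγ.arc i
  have hda := (hγi.analytic t ht).differentiableAt
  have hωs : Tendsto (fun s : ℝ => ω * s) U (𝓝 0) := by
    have : Tendsto (fun s : ℝ => ω * s) (𝓝 0) (𝓝 (ω * ((0 : ℝ) : ℂ))) :=
      (continuous_const.mul Complex.continuous_ofReal).tendsto 0
    rw [Complex.ofReal_zero, mul_zero] at this
    exact this.mono_left hU0
  have hγt : γ i t = z₀ := by
    have h1 : Tendsto (fun s => γ i (τ s)) U (𝓝 (γ i t)) := hda.continuousAt.tendsto.comp hτt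
    have h2 : Tendsto (fun s : ℝ => ψ (ω * s)) U (𝓝 z₀) := by
      have := N.analytic_symm.continuousAt.tendsto.comp hωs
      rwa [N.symm_apply_zero] at this
    exact tendsto_nhds_unique h1 (h2.congr' (hUA.mono fun s hs => (hτ s hs).2.symm))
  have hval : ∀ᶠ s in (U : Filter ℝ), φ (γ i (τ s)) = ω * s := by
    filter_upwards [hUA, hωs.eventually N.right_inv] with s h1 h2
    rw [(hτ s h1).2, h2]
  have hspos : ∀ᶠ s in (U : Filter ℝ), 0 < s := hU1 self_mem_nhdsWithin
  have hτne : ∀ᶠ s in (U : Filter ℝ), τ s ≠ t := by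
    filter_upwards [hval, hspos] with s h1 h2 h3
    rw [h3, hγt, N.apply_base] at h1
    exact mul_ne_zero hω (by exact_mod_cast h2.ne') h1.symm
  have hlim := tendsto_div_sub_of_tendsto (N.hasDerivAt_comp hda hγt)
    (by simp [hγt, N.apply_base]) hτt hτne
  set w := deriv φ z₀ * deriv (γ i) t with hw
  have hw0 : w ≠ 0 := mul_ne_zero N.deriv_ne (hγi.regular t ht)
  -- Comparing `φ (γ i (τ s)) = ω * s` with the derivative of `φ ∘ γ i` shows that `w / ω` is a
  -- limit of real numbers. Their sign is known when the limit parameter is an endpoint.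
  have hlim2 : Tendsto (fun s : ℝ => ((s / (τ s - t) : ℝ) : ℂ)) U (𝓝 (w / ω)) := by
    refine (hlim.div_const ω).congr' ?_
    filter_upwards [hval] with s hs
    rw [hs]
    push_cast
    field_simp
  obtain ⟨h1, h2⟩ := ofReal_re_eq_of_tendsto hlim2
  have hρ0 : (w / ω).re ≠ 0 := fun h => by
    rw [h] at h1
    exact div_ne_zero hw0 hω (by simpa using h1.symm)
  refine ⟨i, t, ht, hγt, (w / ω).re, hρ0, by rw [h1, div_mul_cancel₀ _ hω], ?_, ?_⟩
  · rintro rfl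
    refine lt_of_le_of_ne (ge_of_tendsto h2 ?_) hρ0.symm
    filter_upwards [hspos, hτI] with s h3 h4
    exact div_nonneg h3.le (by linarith [h4.1])
  · rintro rfl
    refine lt_of_le_of_ne (le_of_tendsto h2 ?_) hρ0
    filter_upwards [hspos, hτI] with s h3 h4
    exact div_nonpos_of_nonneg_of_nonpos h3.le (by linarith [h4.2])

theorem im_eval_of_mem_inverseImage {T : Polynomial ℂ} {z : ℂ} (hz : z ∈ inverseImage T) :
    (T.eval z).im = 0 := by
  obtain ⟨x, -, hx⟩ := hz
  rw [hx, Complex.ofReal_im]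

/-- The `m`-th power of the outgoing direction of a curve in `T⁻¹([-1,1])`. -/
theorem IsNormalForm.exists_dir_pow {T : Polynomial ℂ} {z₀ : ℂ} {m : ℕ} {φ ψ : ℂ → ℂ}
    (N : IsNormalForm T z₀ m φ ψ) {γ : ℝ → ℂ} {t δ : ℝ} (hγ : DifferentiableAt ℝ γ t)
    (hz : γ t = z₀) (hmem : ∀ᶠ h in 𝓝[>] (0 : ℝ), γ (t + δ * h) ∈ inverseImage T) :
    ∃ D : ℝ, (δ * (deriv φ z₀ * deriv γ t)) ^ m = D ∧ (T.eval z₀ = 1 → D ≤ 0) ∧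
      (T.eval z₀ = -1 → 0 ≤ D) := by
  have hz' : (fun h => γ (t + δ * h)) 0 = z₀ := by simp [hz]
  have h1 : HasDerivAt (fun h : ℝ => t + δ * h) δ 0 := by
    simpa using ((hasDerivAt_id' (0 : ℝ)).const_mul δ).const_add t
  have hdiff : DifferentiableAt ℝ (fun h => γ (t + δ * h)) 0 :=
    (hγ.hasDerivAt.scomp_of_eq 0 h1 (by simp)).differentiableAt
  have hlim := (N.tendsto_div_pow hdiff hz').mono_left
    (nhdsWithin_mono (0 : ℝ) (fun s (hs : 0 < s) => ne_of_gt hs) : 𝓝[>] (0 : ℝ) ≤ 𝓝[≠] 0)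
  rw [deriv_comp_affine hγ] at hlim
  have him0 : (T.eval z₀).im = 0 := by
    have h2 : Tendsto (fun h => (T.eval (γ (t + δ * h))).im) (𝓝[>] 0) (𝓝 (T.eval z₀).im) := by
      have h3 := (Complex.continuous_im.continuousAt.comp
        (T.continuous.continuousAt.comp hdiff.continuousAt)).tendsto.mono_left
        (nhdsWithin_le_nhds (s := Ioi (0 : ℝ)))
      simpa [hz, Function.comp_def] using h3
    exact tendsto_nhds_unique h2 (tendsto_const_nhds.congr'
      (hmem.mono fun h hh => (im_eval_of_mem_inverseImage hh).symm))
  have hx₀ : T.eval z₀ = ((T.eval z₀).re : ℂ) := Complex.ext rfl (by simpa using him0)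
  set x₀ := (T.eval z₀).re with hx₀def
  have hlim2 : Tendsto (fun s : ℝ => ((((T.eval (γ (t + δ * s))).re - x₀) / s ^ m : ℝ) : ℂ)) (𝓝[>] 0)
      (𝓝 ((deriv φ z₀ * (δ * deriv γ t)) ^ m)) := by
    refine hlim.congr' ?_
    filter_upwards [hmem] with s hs
    have h4 : T.eval (γ (t + δ * s)) = ((T.eval (γ (t + δ * s))).re : ℂ) :=
      Complex.ext rfl (by simpa using im_eval_of_mem_inverseImage hs)
    rw [hx₀, h4]
    push_cast
    simp
  obtain ⟨h2, h3⟩ := ofReal_re_eq_of_tendsto hlim2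
  refine ⟨_, by rw [h2]; ring, fun h => ?_, fun h => ?_⟩
  · refine le_of_tendsto h3 ?_
    filter_upwards [hmem, self_mem_nhdsWithin] with s ⟨x, hx, hxe⟩ (hs : 0 < s)
    have : x₀ = 1 := by rw [hx₀def, h]; simp
    rw [hxe, Complex.ofReal_re, this]
    exact div_nonpos_of_nonpos_of_nonneg (by linarith [hx.2]) (by positivity)
  · refine ge_of_tendsto h3 ?_
    filter_upwards [hmem, self_mem_nhdsWithin] with s ⟨x, hx, hxe⟩ (hs : 0 < s)
    have : x₀ = -1 := by rw [hx₀def, h]; simp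
    rw [hxe, Complex.ofReal_re, this]
    exact div_nonneg (by linarith [hx.1]) (by positivity)

theorem eventually_add_mul_pow_mem_Icc {x D : ℝ} (hx : x ∈ Icc (-1 : ℝ) 1) {m : ℕ} (hm : 0 < m)
    (h1 : x = 1 → D ≤ 0) (h2 : x = -1 → 0 ≤ D) :
    ∀ᶠ s : ℝ in 𝓝[>] 0, x + D * s ^ m ∈ Icc (-1 : ℝ) 1 := by
  have hc : Tendsto (fun s : ℝ => x + D * s ^ m) (𝓝[>] 0) (𝓝 x) := by
    have : Tendsto (fun s : ℝ => x + D * s ^ m) (𝓝 0) (𝓝 (x + D * 0 ^ m)) :=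
      (by fun_prop : Continuous fun s : ℝ => x + D * s ^ m).tendsto 0
    rw [zero_pow hm.ne', mul_zero, add_zero] at this
    exact this.mono_left nhdsWithin_le_nhds
  have hlow : ∀ᶠ s : ℝ in 𝓝[>] 0, -1 ≤ x + D * s ^ m := by
    rcases eq_or_lt_of_le hx.1 with h | h
    · filter_upwards [self_mem_nhdsWithin] with s (hs : 0 < s)
      have := mul_nonneg (h2 h.symm) (pow_nonneg hs.le m)
      linarith
    · exact (hc.eventually (lt_mem_nhds h)).mono fun s hs => le_of_lt hs
  have hup : ∀ᶠ s : ℝ in 𝓝[>] 0, x + D * s ^ m ≤ 1 := by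
    rcases eq_or_lt_of_le hx.2 with h | h
    · filter_upwards [self_mem_nhdsWithin] with s (hs : 0 < s)
      have := mul_nonneg (neg_nonneg.2 (h1 h)) (pow_nonneg hs.le m)
      linarith
    · exact (hc.eventually (gt_mem_nhds h)).mono fun s hs => le_of_lt hs
  exact hlow.and hup

theorem IsNormalForm.eventually_eval_symm {T : Polynomial ℂ} {z₀ : ℂ} {m : ℕ} {φ ψ : ℂ → ℂ}
    (N : IsNormalForm T z₀ m φ ψ) : ∀ᶠ w in 𝓝 0, T.eval (ψ w) = T.eval z₀ + w ^ m := by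
  have h : Tendsto ψ (𝓝 0) (𝓝 z₀) := by
    have := N.analytic_symm.continuousAt.tendsto
    rwa [N.symm_apply_zero] at this
  filter_upwards [h.eventually N.eval_eq, N.right_inv] with w h1 h2
  rw [h1, h2]

/-- Along the ray, `T` equals `T z₀ + D * s ^ m`, which leaves `[-1,1]` only if it starts at `±1`
with the wrong sign of `D`. This is the counterpart of `IsNormalForm.exists_dir_pow`. -/
theorem IsNormalForm.eventually_ray_mem {T : Polynomial ℂ} {z₀ : ℂ} {m : ℕ} {φ ψ : ℂ → ℂ}
    (N : IsNormalForm T z₀ m φ ψ) (hz₀ : z₀ ∈ inverseImage T) {ω : ℂ} {D : ℝ} (hω : ω ^ m = D)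
    (h1 : T.eval z₀ = 1 → D ≤ 0) (h2 : T.eval z₀ = -1 → 0 ≤ D) :
    ∀ᶠ s : ℝ in 𝓝[>] 0, ψ (ω * s) ∈ inverseImage T := by
  obtain ⟨x, hx, hxe⟩ := hz₀
  have hev := eventually_add_mul_pow_mem_Icc (D := D) hx N.pos
    (fun h => h1 (by rw [hxe, h]; simp)) (fun h => h2 (by rw [hxe, h]; simp))
  have hωs : Tendsto (fun s : ℝ => ω * s) (𝓝[>] 0) (𝓝 0) := by
    have : Tendsto (fun s : ℝ => ω * s) (𝓝 0) (𝓝 (ω * ((0 : ℝ) : ℂ))) :=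
      (continuous_const.mul Complex.continuous_ofReal).tendsto 0
    rw [Complex.ofReal_zero, mul_zero] at this
    exact this.mono_left nhdsWithin_le_nhds
  filter_upwards [hev, hωs.eventually N.eventually_eval_symm] with s h3 h4
  refine ⟨_, h3, ?_⟩
  rw [h4, mul_pow, hω, hxe]
  push_cast
  ring

theorem eval_eq_one_or_of_isRoot {T : Polynomial ℂ} {z : ℂ} (h : (T ^ 2 - 1).IsRoot z) :
    T.eval z = 1 ∨ T.eval z = -1 := by
  have h1 : T.eval z ^ 2 = 1 := by
    have : T.eval z ^ 2 - 1 = 0 := by simpa using h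
    linear_combination this
  exact mul_self_eq_one_iff.1 (by rw [← sq, h1])

theorem sq_sub_one_ne_zero {T : Polynomial ℂ} (hT : 0 < T.natDegree) : T ^ 2 - 1 ≠ 0 := by
  intro h
  have := congrArg Polynomial.natDegree (sub_eq_zero.1 h)
  rw [Polynomial.natDegree_pow, Polynomial.natDegree_one] at this
  omega

theorem rootMultiplicity_sq_sub_one {T : Polynomial ℂ} (hT : 0 < T.natDegree) {z : ℂ}
    (h : T.eval z = 1 ∨ T.eval z = -1) :
    (T ^ 2 - 1).rootMultiplicity z = (T - Polynomial.C (T.eval z)).rootMultiplicity z := by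
  have h1 : T.eval z ^ 2 = 1 := by rcases h with h | h <;> simp [h]
  have h0 : T.eval z ≠ 0 := by rcases h with h | h <;> simp [h]
  have hfac : T ^ 2 - 1 = (T - Polynomial.C (T.eval z)) * (T + Polynomial.C (T.eval z)) := by
    have : (1 : Polynomial ℂ) = Polynomial.C (T.eval z) ^ 2 := by
      rw [← Polynomial.C_pow, h1, Polynomial.C_1]
    rw [this]; ring
  have hne := sq_sub_one_ne_zero hT
  rw [hfac] at hne ⊢
  rw [Polynomial.rootMultiplicity_mul hne, Polynomial.rootMultiplicity_eq_zero (p := T + _), add_zero]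
  simp only [Polynomial.IsRoot, Polynomial.eval_add, Polynomial.eval_C]
  intro h2
  exact h0 (by linear_combination h2 / 2)

/-- A zero of `T ^ 2 - 1` in the interior of a regular curve in `T⁻¹([-1,1])` has even
multiplicity. -/
theorem even_rootMultiplicity_of_interior {T : Polynomial ℂ} (hT : 0 < T.natDegree) {γ : ℝ → ℂ}
    {t : ℝ} (hγ : DifferentiableAt ℝ γ t) (h0 : deriv γ t ≠ 0)
    (hmem : ∀ᶠ s in 𝓝 t, γ s ∈ inverseImage T) (hroot : (T ^ 2 - 1).IsRoot (γ t)) :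
    Even ((T ^ 2 - 1).rootMultiplicity (γ t)) := by
  obtain ⟨m, φ, ψ, N⟩ := exists_isNormalForm hT (γ t)
  have hε := eval_eq_one_or_of_isRoot hroot
  rw [rootMultiplicity_sq_sub_one hT hε, N.mult]
  by_contra hodd
  rw [Nat.not_even_iff_odd] at hodd
  have hm : ∀ δ : ℝ, ∀ᶠ h in 𝓝[>] (0 : ℝ), γ (t + δ * h) ∈ inverseImage T := fun δ => by
    have : Tendsto (fun h : ℝ => t + δ * h) (𝓝 0) (𝓝 (t + δ * 0)) :=
      (by fun_prop : Continuous fun h : ℝ => t + δ * h).tendsto 0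
    rw [mul_zero, add_zero] at this
    exact (this.mono_left nhdsWithin_le_nhds).eventually hmem
  -- For odd `m` the two opposite directions of the curve have `m`-th powers `D₁` and `-D₁`, but
  -- both must have the sign imposed by `T z₀ = ±1`.
  obtain ⟨D₁, hD₁, ha₁, hb₁⟩ := N.exists_dir_pow hγ rfl (hm 1)
  obtain ⟨D₂, hD₂, ha₂, hb₂⟩ := N.exists_dir_pow hγ rfl (hm (-1))
  rw [Complex.ofReal_one, one_mul] at hD₁
  rw [Complex.ofReal_neg, Complex.ofReal_one, neg_one_mul, hodd.neg_pow, hD₁] at hD₂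
  have h12 : -D₁ = D₂ := by exact_mod_cast hD₂
  have hne : D₁ ≠ 0 := by
    rintro rfl
    exact pow_ne_zero m (mul_ne_zero N.deriv_ne h0) (by simpa using hD₁)
  rcases hε with h | h
  · have h3 := ha₁ h
    have h4 := ha₂ h
    exact hne (by linarith)
  · have h3 := hb₁ h
    have h4 := hb₂ h
    exact hne (by linarith)

/-! ### Ends of arcs compared with zeros of odd multiplicity -/

/-- The parameter of the initial (`false`) or the final (`true`) endpoint of an arc. -/
def endParam : Bool → ℝ
  | false => 0
  | true => 1

/-- The sign of the parameter direction that leads from an endpoint into the arc. -/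
def endSign : Bool → ℝ
  | false => 1
  | true => -1

theorem endParam_mem (e : Bool) : endParam e ∈ Icc (0 : ℝ) 1 := by
  cases e <;> simp [endParam]

theorem endSign_mul_self (e : Bool) : endSign e * endSign e = 1 := by
  cases e <;> simp [endSign]

theorem endSign_ne_zero (e : Bool) : endSign e ≠ 0 := by
  cases e <;> simp [endSign]

/-- The ends of the arcs `γ i` at the point `z`. -/
noncomputable def endsAt {k : ℕ} (γ : Fin k → ℝ → ℂ) (z : ℂ) : Finset (Fin k × Bool) :=
  Finset.univ.filter fun e => γ e.1 (endParam e.2) = z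

theorem card_filter_prod_bool {α : Type*} [Fintype α] (p : α × Bool → Prop) [DecidablePred p] :
    (Finset.univ.filter p).card = (Finset.univ.filter fun a => p (a, false)).card +
      (Finset.univ.filter fun a => p (a, true)).card := by
  simp only [Finset.card_filter, Fintype.sum_prod_type, Fintype.sum_bool, Finset.sum_add_distrib]
  rw [add_comm]

theorem count_arcEndpoints {k : ℕ} (γ : Fin k → ℝ → ℂ) (z : ℂ) :
    (arcEndpoints γ).count z = (endsAt γ z).card := by
  rw [arcEndpoints, Multiset.count_add, Multiset.count_map, Multiset.count_map, endsAt,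
    card_filter_prod_bool]
  simp only [Finset.card_def, Finset.filter_val]
  congr 1 <;> exact congrArg _ (Multiset.filter_congr fun i _ => eq_comm)

theorem card_arcEndpoints {k : ℕ} (γ : Fin k → ℝ → ℂ) : (arcEndpoints γ).card = 2 * k := by
  simp [arcEndpoints, two_mul]

theorem count_oddZeros (Q : Polynomial ℂ) (z : ℂ) :
    (oddZeros Q).count z = if Odd (Q.rootMultiplicity z) then Q.rootMultiplicity z else 0 := by
  rw [oddZeros, Multiset.count_filter, Polynomial.count_roots]

/-- The `m`-th roots of a nonzero complex number. -/
theorem exists_finset_pow_eq {m : ℕ} (hm : 0 < m) {a : ℂ} (ha : a ≠ 0) :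
    ∃ s : Finset ℂ, s.card = m ∧ ∀ z, z ∈ s ↔ z ^ m = a := by
  set p : Polynomial ℂ := Polynomial.X ^ m - Polynomial.C a with hp
  have hsep : p.Separable := Polynomial.separable_X_pow_sub_C a (by exact_mod_cast hm.ne') ha
  have hp0 : p ≠ 0 := hsep.ne_zero
  refine ⟨p.roots.toFinset, ?_, fun z => ?_⟩
  · rw [Multiset.toFinset_card_of_nodup (Polynomial.nodup_roots hsep),
      ← (IsAlgClosed.splits p).natDegree_eq_card_roots, hp, Polynomial.natDegree_X_pow_sub_C]
  · rw [Multiset.mem_toFinset, Polynomial.mem_roots hp0]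
    simp [hp, sub_eq_zero]

theorem norm_eq_one_of_pow_eq {m : ℕ} (hm : 0 < m) {ω : ℂ} {D : ℝ} (hD : |D| = 1)
    (h : ω ^ m = D) : ‖ω‖ = 1 := by
  have h1 := congrArg norm h
  rw [norm_pow, Complex.norm_real, Real.norm_eq_abs, hD] at h1
  exact (pow_eq_one_iff_of_nonneg (norm_nonneg _) hm.ne').1 h1

theorem div_norm_of_pos_mul {d ω : ℂ} {ρ : ℝ} (hρ : 0 < ρ) (hω : ‖ω‖ = 1) (h : d = ρ * ω) :
    d / (‖d‖ : ℂ) = ω := by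
  have h1 : ‖d‖ = ρ := by
    rw [h, norm_mul, hω, Complex.norm_real, Real.norm_eq_abs, abs_of_pos hρ, mul_one]
  rw [h1, h, mul_div_cancel_left₀]
  exact_mod_cast hρ.ne'

theorem IsArcCover.trace_subset {S : Set ℂ} {k : ℕ} {γ : Fin k → ℝ → ℂ} (hγ : IsArcCover S γ)
    (i : Fin k) : arcTrace (γ i) ⊆ S := by
  rw [← hγ.union]; exact subset_iUnion (fun i => arcTrace (γ i)) i

/-- The outgoing direction at an end of an arc, in a coordinate with derivative `κ`. -/
noncomputable def outDir (κ : ℂ) (γ : ℝ → ℂ) (e : Bool) : ℂ :=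
  endSign e * (κ * deriv γ (endParam e))

theorem outDir_ne_zero {κ : ℂ} (hκ : κ ≠ 0) {γ : ℝ → ℂ} (hγ : IsAnalyticArcParam γ) (e : Bool) :
    outDir κ γ e ≠ 0 :=
  mul_ne_zero (by exact_mod_cast endSign_ne_zero e)
    (mul_ne_zero hκ (hγ.regular _ (endParam_mem e)))

/-- Every zero of odd multiplicity is, often enough, an endpoint of the arcs. -/
theorem IsArcCover.oddZeros_le {T : Polynomial ℂ} (hT : 0 < T.natDegree) {k : ℕ}
    {γ : Fin k → ℝ → ℂ} (hγ : IsArcCover (inverseImage T) γ) :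
    oddZeros (T ^ 2 - 1) ≤ arcEndpoints γ := by
  rw [Multiset.le_iff_count]
  intro z₀
  rw [count_oddZeros, count_arcEndpoints]
  split_ifs with hodd
  swap
  · exact Nat.zero_le _
  have hroot : (T ^ 2 - 1).IsRoot z₀ :=
    (Polynomial.rootMultiplicity_pos (sq_sub_one_ne_zero hT)).1 hodd.pos
  have hε := eval_eq_one_or_of_isRoot hroot
  obtain ⟨m, φ, ψ, N⟩ := exists_isNormalForm hT z₀
  obtain ⟨D, hTD, hD⟩ : ∃ D : ℝ, T.eval z₀ = ((-D : ℝ) : ℂ) ∧ |D| = 1 := by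
    rcases hε with h | h
    · exact ⟨-1, by rw [h]; simp, by simp⟩
    · exact ⟨1, by rw [h]; simp, by simp⟩
  have hD0 : (D : ℂ) ≠ 0 := by
    have : D ≠ 0 := by rintro rfl; simp at hD
    exact_mod_cast this
  have hz₀ : z₀ ∈ inverseImage T := ⟨-D, abs_le.1 (by rw [abs_neg, hD]), hTD⟩
  have hmult : (T ^ 2 - 1).rootMultiplicity z₀ = m := by
    rw [rootMultiplicity_sq_sub_one hT hε, N.mult]
  obtain ⟨s, hs, hmem⟩ := exists_finset_pow_eq N.pos hD0
  rw [hmult, ← hs]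
  -- The admissible unit directions are the `m` solutions of `ω ^ m = D`; each turns out to be the
  -- normalised outgoing direction of an end at `z₀`.
  refine Finset.card_le_card_of_surjOn
    (fun e : Fin k × Bool => outDir (deriv φ z₀) (γ e.1) e.2 /
      (‖outDir (deriv φ z₀) (γ e.1) e.2‖ : ℂ)) ?_
  intro ω hω
  rw [Finset.mem_coe, hmem] at hω
  have hω1 := norm_eq_one_of_pow_eq N.pos hD hω
  have hω0 : ω ≠ 0 := norm_ne_zero_iff.1 (by rw [hω1]; exact one_ne_zero)
  have hray := N.eventually_ray_mem hz₀ hω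
    (fun h => by
      rw [hTD] at h
      have : -D = 1 := by exact_mod_cast h
      linarith)
    (fun h => by
      rw [hTD] at h
      have : -D = -1 := by exact_mod_cast h
      linarith)
  obtain ⟨i, t, ht, hit, ρ, hρ, hd, h0, h1⟩ := hγ.exists_tangent N hω0 hray
  have key : ∃ e : Bool, endParam e = t ∧ 0 < endSign e * ρ := by
    rcases eq_or_lt_of_le ht.1 with h | h
    · exact ⟨false, h, by simpa [endSign] using h0 h.symm⟩
    rcases eq_or_lt_of_le ht.2 with h' | h'
    · exact ⟨true, h'.symm, by simpa [endSign] using h1 h'⟩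
    -- An interior passage of an arc through `z₀` would force even multiplicity.
    · exfalso
      have hev : ∀ᶠ s in 𝓝 t, γ i s ∈ inverseImage T := by
        filter_upwards [Icc_mem_nhds h h'] with s hs
        exact hγ.trace_subset i (mem_image_of_mem _ hs)
      have := even_rootMultiplicity_of_interior hT ((hγ.arc i).analytic t ht).differentiableAt
        ((hγ.arc i).regular t ht) hev (by rw [hit]; exact hroot)
      rw [hit] at this
      exact Nat.not_even_iff_odd.2 hodd this
  obtain ⟨e, rfl, he⟩ := key
  refine ⟨(i, e), ?_, ?_⟩
  · simp [endsAt, hit]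
  · refine div_norm_of_pos_mul he hω1 ?_
    simp only [outDir]
    rw [hd]; push_cast; ring

/-- No two of the arcs have a common point with parallel tangents. -/
def NoParallelContact {k : ℕ} (γ : Fin k → ℝ → ℂ) : Prop :=
  ∀ i j, i ≠ j → ∀ s ∈ Icc (0 : ℝ) 1, ∀ t ∈ Icc (0 : ℝ) 1, γ i s = γ j t →
    ∀ c : ℝ, deriv (γ j) t ≠ c * deriv (γ i) s

/-- If the arcs have no parallel contacts, then every arc ends at zeros of odd multiplicity, and not
more often than the multiplicity. -/
theorem IsArcCover.arcEndpoints_le {T : Polynomial ℂ} (hT : 0 < T.natDegree) {k : ℕ}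
    {γ : Fin k → ℝ → ℂ} (hγ : IsArcCover (inverseImage T) γ) (hP : NoParallelContact γ) :
    arcEndpoints γ ≤ oddZeros (T ^ 2 - 1) := by
  rw [Multiset.le_iff_count]
  intro z₀
  rw [count_oddZeros, count_arcEndpoints]
  rcases (endsAt γ z₀).eq_empty_or_nonempty with hemp | hne
  · simp [hemp]
  obtain ⟨m, φ, ψ, N⟩ := exists_isNormalForm hT z₀
  have hmemS : ∀ i, ∀ t ∈ Icc (0 : ℝ) 1, γ i t ∈ inverseImage T := fun i t ht =>
    hγ.trace_subset i (mem_image_of_mem _ ht)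
  have hdiff : ∀ i, ∀ t ∈ Icc (0 : ℝ) 1, DifferentiableAt ℝ (γ i) t := fun i t ht =>
    ((hγ.arc i).analytic t ht).differentiableAt
  have hz₀ : z₀ ∈ inverseImage T := by
    obtain ⟨e, he⟩ := hne
    simp only [endsAt, Finset.mem_filter, Finset.mem_univ, true_and] at he
    rw [← he]
    exact hmemS _ _ (endParam_mem _)
  have hdir : ∀ e ∈ endsAt γ z₀, ∃ D : ℝ, outDir (deriv φ z₀) (γ e.1) e.2 ^ m = D ∧
      (T.eval z₀ = 1 → D ≤ 0) ∧ (T.eval z₀ = -1 → 0 ≤ D) := by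
    rintro ⟨i, e⟩ he
    simp only [endsAt, Finset.mem_filter, Finset.mem_univ, true_and] at he
    have hz := he
    refine N.exists_dir_pow (δ := endSign e) (hdiff i _ (endParam_mem e)) hz |> fun h => ?_
    have hev : ∀ᶠ h in 𝓝[>] (0 : ℝ), γ i (endParam e + endSign e * h) ∈ inverseImage T := by
      filter_upwards [Ioo_mem_nhdsGT (zero_lt_one (α := ℝ))] with s hs
      refine hmemS i _ ?_
      cases e <;> simp only [endParam, endSign] <;> constructor <;> linarith [hs.1, hs.2]
    obtain ⟨D, h1, h2, h3⟩ := h hev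
    rw [he] at *
    exact ⟨D, h1, h2, h3⟩
  -- Otherwise the ray opposite to an end also lies in `S`, and some arc is tangent to it. A
  -- different arc gives a parallel contact. The same arc would, by injectivity, be at the same end,
  -- where its outgoing direction cannot point backwards.
  have hvertex : (T.eval z₀ = 1 ∨ T.eval z₀ = -1) ∧ Odd m := by
    by_contra hcon
    obtain ⟨⟨i, e⟩, he⟩ := hne
    obtain ⟨D, hD, hD1, hD2⟩ := hdir _ he
    simp only [endsAt, Finset.mem_filter, Finset.mem_univ, true_and] at he
    set d := outDir (deriv φ z₀) (γ i) e with hd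
    have hd0 : d ≠ 0 := outDir_ne_zero N.deriv_ne (hγ.arc i) e
    have hray : ∀ᶠ s : ℝ in 𝓝[>] 0, ψ (-d * s) ∈ inverseImage T := by
      by_cases hT1 : T.eval z₀ = 1 ∨ T.eval z₀ = -1
      · have hev : Even m := Nat.not_odd_iff_even.1 fun h => hcon ⟨hT1, h⟩
        exact N.eventually_ray_mem hz₀ (by rw [hev.neg_pow, hD]) hD1 hD2
      · refine N.eventually_ray_mem hz₀ (D := (-1) ^ m * D) (by rw [neg_pow, hD]; push_cast; rfl)
          (fun h => absurd (Or.inl h) hT1) (fun h => absurd (Or.inr h) hT1)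
    obtain ⟨j, t, ht, hjt, ρ, hρ, hdρ, h0, h1⟩ := hγ.exists_tangent N (neg_ne_zero.2 hd0) hray
    by_cases hij : i = j
    · subst hij
      have := (hγ.arc i).injective ht (endParam_mem e) (hjt.trans he.symm)
      subst this
      have h2 : ((endSign e * ρ : ℝ) : ℂ) * d = -d := by
        have h3 : ((endSign e * endSign e : ℝ) : ℂ) = 1 := by rw [endSign_mul_self]; simp
        have h4 : d = endSign e * (ρ * -d) := by rw [← hdρ]; rfl
        push_cast
        linear_combination h4
      have h3 : ((endSign e * ρ : ℝ) : ℂ) = ((-1 : ℝ) : ℂ) := by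
        refine mul_right_cancel₀ hd0 ?_
        rw [h2]; simp
      have h4 : endSign e * ρ = -1 := by exact_mod_cast h3
      cases e
      · simp only [endSign, one_mul] at h4
        have := h0 rfl
        linarith
      · simp only [endSign] at h4
        have := h1 rfl
        linarith
    · refine hP i j hij _ (endParam_mem e) t ht (he.trans hjt.symm) (-ρ * endSign e) ?_
      refine mul_left_cancel₀ N.deriv_ne ?_
      rw [hdρ, hd, outDir]
      push_cast
      ring
  obtain ⟨hε, hodd⟩ := hvertex
  have hmult : (T ^ 2 - 1).rootMultiplicity z₀ = m := by
    rw [rootMultiplicity_sq_sub_one hT hε, N.mult]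
  rw [hmult, if_pos hodd]
  obtain ⟨D', hD', hDe⟩ : ∃ D' : ℝ, |D'| = 1 ∧ ∀ D : ℝ, (T.eval z₀ = 1 → D ≤ 0) →
      (T.eval z₀ = -1 → 0 ≤ D) → D = |D| * D' := by
    rcases hε with h | h
    · exact ⟨-1, by simp, fun D h1 _ => by rw [abs_of_nonpos (h1 h)]; ring⟩
    · exact ⟨1, by simp, fun D _ h2 => by rw [abs_of_nonneg (h2 h)]; ring⟩
  have hD'0 : (D' : ℂ) ≠ 0 := by
    have : D' ≠ 0 := by rintro rfl; simp at hD'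
    exact_mod_cast this
  obtain ⟨s, hs, hmem⟩ := exists_finset_pow_eq N.pos hD'0
  rw [← hs]
  -- At most `m` ends fit: each normalised direction is one of the `m` admissible ones, and two ends
  -- sharing a direction would be a parallel contact. The two ends of one arc are distinct points,
  -- so they do not both occur here.
  refine Finset.card_le_card_of_injOn
    (fun e : Fin k × Bool => outDir (deriv φ z₀) (γ e.1) e.2 /
      (‖outDir (deriv φ z₀) (γ e.1) e.2‖ : ℂ)) ?_ ?_
  · intro e he
    obtain ⟨D, hD, hD1, hD2⟩ := hdir e he
    rw [Finset.mem_coe, hmem]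
    have hd0 := outDir_ne_zero N.deriv_ne (hγ.arc e.1) e.2
    set d := outDir (deriv φ z₀) (γ e.1) e.2
    have h1 : ‖d‖ ^ m = |D| := by rw [← norm_pow, hD, Complex.norm_real, Real.norm_eq_abs]
    have h2 : (‖d‖ : ℂ) ^ m ≠ 0 := pow_ne_zero _ (by exact_mod_cast norm_ne_zero_iff.2 hd0)
    rw [div_pow, hD, div_eq_iff h2, ← Complex.ofReal_pow, h1, hDe D hD1 hD2, abs_mul, hD']
    push_cast
    simp [mul_comm]
  · rintro ⟨i, e⟩ he ⟨j, f⟩ hf hef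
    simp only [endsAt, Finset.coe_filter, Finset.mem_univ, true_and, mem_ofPred_eq] at he hf
    by_cases hij : i = j
    · subst hij
      have := (hγ.arc i).injective (endParam_mem e) (endParam_mem f) (he.trans hf.symm)
      cases e <;> cases f <;> simp [endParam] at this ⊢
    · exfalso
      have hd0 := outDir_ne_zero N.deriv_ne (hγ.arc i) e
      have hd0' := outDir_ne_zero N.deriv_ne (hγ.arc j) f
      simp only at hef
      set d := outDir (deriv φ z₀) (γ i) e with hd
      set d' := outDir (deriv φ z₀) (γ j) f with hd'
      have hn : (‖d‖ : ℂ) ≠ 0 := by exact_mod_cast norm_ne_zero_iff.2 hd0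
      have hn' : (‖d'‖ : ℂ) ≠ 0 := by exact_mod_cast norm_ne_zero_iff.2 hd0'
      refine hP i j hij _ (endParam_mem e) _ (endParam_mem f) (he.trans hf.symm)
        (endSign f * (‖d'‖ / ‖d‖) * endSign e) ?_
      refine mul_left_cancel₀ N.deriv_ne ?_
      have h1 : d' = (‖d'‖ / ‖d‖ : ℂ) * d := by
        rw [div_eq_div_iff hn hn'] at hef
        field_simp
        linear_combination -hef
      have h3 : ∀ b : Bool, (endSign b : ℂ) * endSign b = 1 := fun b => by
        rw [← Complex.ofReal_mul, endSign_mul_self, Complex.ofReal_one]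
      have h5 : deriv φ z₀ * deriv (γ j) (endParam f) = endSign f * d' := by
        rw [hd', outDir, ← mul_assoc, h3, one_mul]
      have h6 : deriv φ z₀ * deriv (γ i) (endParam e) = endSign e * d := by
        rw [hd, outDir, ← mul_assoc, h3, one_mul]
      rw [h5, mul_left_comm, h6]
      push_cast
      linear_combination (endSign f : ℂ) * h1 - (endSign f : ℂ) * (‖d'‖ / ‖d‖) * d * h3 e

/-- Arcs without parallel contacts meet in finitely many points. -/
theorem NoParallelContact.finite_inter {k : ℕ} {γ : Fin k → ℝ → ℂ} (hP : NoParallelContact γ)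
    (hγ : ∀ i, IsAnalyticArcParam (γ i)) {i j : Fin k} (hij : i ≠ j) :
    (arcTrace (γ i) ∩ arcTrace (γ j)).Finite := by
  by_contra hinf
  set A := arcTrace (γ i) ∩ arcTrace (γ j) with hA
  have hcpt : IsCompact (arcTrace (γ i)) := isCompact_Icc.image_of_continuousOn
    (hγ i).analytic.continuousOn
  obtain ⟨z₀, -, hz₀⟩ := Set.Infinite.exists_accPt_of_subset_isCompact hinf hcpt inter_subset_left
  have hne : (𝓝[≠] z₀ ⊓ 𝓟 A).NeBot := hz₀
  set U := Ultrafilter.of (𝓝[≠] z₀ ⊓ 𝓟 A) with hU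
  have hUle : (U : Filter ℂ) ≤ 𝓝[≠] z₀ ⊓ 𝓟 A := Ultrafilter.of_le _
  have hU1 : (U : Filter ℂ) ≤ 𝓝[≠] z₀ := hUle.trans inf_le_left
  have hU0 : (U : Filter ℂ) ≤ 𝓝 z₀ := hU1.trans nhdsWithin_le_nhds
  have hUA : ∀ᶠ z in (U : Filter ℂ), z ∈ A := hUle.trans inf_le_right (mem_principal_self A)
  have hUne : ∀ᶠ z in (U : Filter ℂ), z ≠ z₀ := hU1 self_mem_nhdsWithin
  -- At an accumulation point of the intersection, chords to common points approximate the tangents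
  -- of both arcs. Each chord is divided by a real parameter difference, so the ratio of the
  -- tangents is a limit of real numbers.
  have hpar : ∀ l : Fin k, (∀ z ∈ A, z ∈ arcTrace (γ l)) → ∃ t ∈ Icc (0 : ℝ) 1, γ l t = z₀ ∧
      ∃ τ : ℂ → ℝ, (∀ᶠ z in (U : Filter ℂ), τ z ≠ t) ∧
        Tendsto (fun z => (z - z₀) / ((τ z - t : ℝ) : ℂ)) U (𝓝 (deriv (γ l) t)) := by
    intro l hl
    have hchoice : ∀ z, ∃ τ, z ∈ A → τ ∈ Icc (0 : ℝ) 1 ∧ γ l τ = z := fun z => by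
      by_cases hz : z ∈ A
      · obtain ⟨τ, h1, h2⟩ := hl z hz
        exact ⟨τ, fun _ => ⟨h1, h2⟩⟩
      · exact ⟨0, fun h => absurd h hz⟩
    choose τ hτ using hchoice
    obtain ⟨t, ht, hUt⟩ := (isCompact_Icc (a := (0 : ℝ)) (b := 1)).ultrafilter_le_nhds
      (U.map τ) (by
        rw [le_principal_iff]
        exact hUA.mono fun z hz => (hτ z hz).1)
    have hτt : Tendsto τ U (𝓝 t) := hUt
    have hda := ((hγ l).analytic t ht).differentiableAt
    have hlt : γ l t = z₀ := by
      have h1 : Tendsto (fun z => γ l (τ z)) U (𝓝 (γ l t)) := hda.continuousAt.tendsto.comp hτt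
      exact tendsto_nhds_unique (h1.congr' (hUA.mono fun z hz => (hτ z hz).2)) hU0
    have hτne : ∀ᶠ z in (U : Filter ℂ), τ z ≠ t := by
      filter_upwards [hUA, hUne] with z h1 h2 h3
      exact h2 (by rw [← (hτ z h1).2, h3, hlt])
    refine ⟨t, ht, hlt, τ, hτne, ?_⟩
    have h2 := tendsto_div_sub_of_tendsto (g := fun s => γ l s - z₀)
      (hda.hasDerivAt.sub_const z₀) (by simp [hlt]) hτt hτne
    refine h2.congr' ?_
    filter_upwards [hUA] with z hz
    rw [(hτ z hz).2]
  obtain ⟨s, hs, his, τ, hτ, hτl⟩ := hpar i fun z hz => hz.1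
  obtain ⟨t, ht, hjt, σ, hσ, hσl⟩ := hpar j fun z hz => hz.2
  have hi0 := (hγ i).regular s hs
  have hlim : Tendsto (fun z => (((τ z - s) / (σ z - t) : ℝ) : ℂ)) U
      (𝓝 (deriv (γ j) t / deriv (γ i) s)) := by
    refine (hσl.div hτl hi0).congr' ?_
    filter_upwards [hUne, hτ, hσ] with z h1 h2 h3
    have h4 : (z - z₀) ≠ 0 := sub_ne_zero.2 h1
    have h5 : ((τ z - s : ℝ) : ℂ) ≠ 0 := by exact_mod_cast sub_ne_zero.2 h2
    have h6 : ((σ z - t : ℝ) : ℂ) ≠ 0 := by exact_mod_cast sub_ne_zero.2 h3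
    simp only [Pi.div_apply]
    rw [Complex.ofReal_div]
    field_simp
  obtain ⟨h1, -⟩ := ofReal_re_eq_of_tendsto hlim
  exact hP i j hij s hs t ht (his.trans hjt.symm) _ (by rw [h1, div_mul_cancel₀ _ hi0])

/-! ### Existence of finite covers and minimal covers -/

theorem isCompact_inverseImage {T : Polynomial ℂ} (hT : 0 < T.natDegree) :
    IsCompact (inverseImage T) := by
  have hcl : IsClosed (inverseImage T) := by
    have h1 : IsClosed ((fun x : ℝ => (x : ℂ)) '' Icc (-1 : ℝ) 1) :=
      (isCompact_Icc.image Complex.continuous_ofReal).isClosed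
    have h2 : inverseImage T = (fun z => T.eval z) ⁻¹' ((fun x : ℝ => (x : ℂ)) '' Icc (-1 : ℝ) 1) := by
      ext z
      simp only [inverseImage, mem_preimage, mem_image, mem_ofPred_eq, eq_comm]
    rw [h2]
    exact h1.preimage T.continuous
  have h3 := T.tendsto_norm_atTop (Polynomial.natDegree_pos_iff_degree_pos.1 hT)
    (tendsto_norm_cocompact_atTop (E := ℂ))
  obtain ⟨K, hK, hKs⟩ := mem_cocompact.1 (h3.eventually (eventually_gt_atTop 1))
  refine hK.of_isClosed_subset hcl fun z hz => ?_
  by_contra hzK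
  obtain ⟨x, hx, hxe⟩ := hz
  have h4 : 1 < ‖T.eval z‖ := hKs hzK
  rw [hxe, Complex.norm_real, Real.norm_eq_abs] at h4
  exact absurd (abs_le.2 hx) (not_le.2 h4)

theorem eventually_pow_le_of_pos {c : ℝ} (hc : 0 < c) {m : ℕ} (hm : 0 < m) :
    ∀ᶠ r : ℝ in 𝓝[>] 0, r ^ m ≤ c := by
  have : Tendsto (fun s : ℝ => s ^ m) (𝓝 0) (𝓝 (0 ^ m)) := (continuous_pow m).tendsto 0
  rw [zero_pow hm.ne'] at this
  exact ((this.mono_left nhdsWithin_le_nhds).eventually (gt_mem_nhds hc)).mono fun s hs => le_of_lt hs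

/-- Locally `T⁻¹([-1,1])` is a finite union of analytic Jordan arcs. -/
theorem exists_finite_arcs_nhdsWithin {T : Polynomial ℂ} (hT : 0 < T.natDegree) {z₀ : ℂ}
    (hz₀ : z₀ ∈ inverseImage T) :
    ∃ 𝒞 : Set (Set ℂ), 𝒞.Finite ∧ (∀ C ∈ 𝒞, IsAnalyticJordanArc C ∧ C ⊆ inverseImage T) ∧
      ⋃₀ 𝒞 ∈ 𝓝[inverseImage T] z₀ := by
  obtain ⟨m, φ, ψ, N⟩ := exists_isNormalForm hT z₀
  obtain ⟨x, hx, hxe⟩ := hz₀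
  have hev : ∀ᶠ w in 𝓝 (0 : ℂ), AnalyticAt ℂ ψ w ∧ deriv ψ w ≠ 0 ∧ φ (ψ w) = w ∧
      T.eval (ψ w) = T.eval z₀ + w ^ m :=
    N.analytic_symm.eventually_analyticAt.and
      ((N.analytic_symm.deriv.continuousAt.eventually_ne N.deriv_symm_ne).and
        (N.right_inv.and N.eventually_eval_symm))
  obtain ⟨R, hR, hRw⟩ := Metric.eventually_nhds_iff_ball.1 hev
  -- The radius is small enough that `x ± r ^ m` stays in `[-1,1]`, except in a direction that is
  -- inadmissible because `x` is already an endpoint.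
  have h1 : ∀ᶠ r : ℝ in 𝓝[>] 0, x ≠ 1 → r ^ m ≤ 1 - x := by
    by_cases h : x = 1
    · exact Eventually.of_forall fun r h' => absurd h h'
    · exact (eventually_pow_le_of_pos (sub_pos.2 (lt_of_le_of_ne hx.2 h)) N.pos).mono fun r hr _ => hr
  have h2 : ∀ᶠ r : ℝ in 𝓝[>] 0, x ≠ -1 → r ^ m ≤ 1 + x := by
    by_cases h : x = -1
    · exact Eventually.of_forall fun r h' => absurd h h'
    · have h3 : 0 < 1 + x := by
        have := lt_of_le_of_ne hx.1 (Ne.symm h)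
        linarith
      exact (eventually_pow_le_of_pos h3 N.pos).mono fun r hr _ => hr
  obtain ⟨r, hr1, hr2, hr3⟩ := (h1.and (h2.and (Ioo_mem_nhdsGT hR))).exists
  have hr0 : 0 < r := hr3.1
  have hball : ∀ ω : ℂ, ‖ω‖ = 1 → ∀ s ∈ Icc (0 : ℝ) 1, (r * ω * s : ℂ) ∈ Metric.ball (0 : ℂ) R := by
    intro ω hω s hs
    rw [mem_ball_zero_iff, norm_mul, norm_mul, hω, Complex.norm_real, Complex.norm_real,
      Real.norm_eq_abs, Real.norm_eq_abs, abs_of_pos hr0, abs_of_nonneg hs.1]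
    nlinarith [hs.2, hr3.2]
  set arc : ℂ → ℝ → ℂ := fun ω s => ψ (r * ω * s) with harc
  have hparam : ∀ ω : ℂ, ‖ω‖ = 1 → IsAnalyticArcParam (arc ω) := by
    intro ω hω
    have hω0 : (r * ω : ℂ) ≠ 0 :=
      mul_ne_zero (by exact_mod_cast hr0.ne') (norm_ne_zero_iff.1 (by rw [hω]; exact one_ne_zero))
    refine ⟨fun s hs => ?_, fun s hs t ht hst => ?_, fun s hs => ?_⟩
    · refine AnalyticAt.fun_comp (f := fun s : ℝ => (r * ω * s : ℂ))
        (hRw _ (hball ω hω s hs)).1.restrictScalars ?_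
      exact analyticAt_const.mul (Complex.ofRealCLM.analyticAt s)
    · have h4 := congrArg φ hst
      simp only [harc] at h4
      rw [(hRw _ (hball ω hω s hs)).2.2.1, (hRw _ (hball ω hω t ht)).2.2.1] at h4
      exact_mod_cast mul_left_cancel₀ hω0 h4
    · have h4 : HasDerivAt (fun s : ℝ => (r * ω * s : ℂ)) (r * ω) s := by
        simpa using ((hasDerivAt_id' s).ofReal_comp).const_mul (r * ω : ℂ)
      have h5 := (hRw _ (hball ω hω s hs)).1.differentiableAt.hasDerivAt.comp_of_eq s h4 rfl
      have h6 : deriv (arc ω) s = deriv ψ (r * ω * s) * (r * ω) := h5.deriv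
      rw [h6]
      exact mul_ne_zero (hRw _ (hball ω hω s hs)).2.1 hω0
  -- The `2 * m`-th roots of unity are the unit directions with `ω ^ m = ±1`, hence all candidates
  -- for rays; those leaving `S` are discarded below.
  obtain ⟨Ω, -, hΩ⟩ := exists_finset_pow_eq (m := 2 * m) (by have := N.pos; omega) (one_ne_zero (α := ℂ))
  have hΩnorm : ∀ ω ∈ Ω, ‖ω‖ = 1 := fun ω hω =>
    norm_eq_one_of_pow_eq (m := 2 * m) (D := 1) (by have := N.pos; omega) (by simp)
      (by simpa using (hΩ ω).1 hω)
  refine ⟨{C | (∃ ω ∈ Ω, arcTrace (arc ω) = C) ∧ C ⊆ inverseImage T}, ?_, ?_, ?_⟩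
  · refine (Ω.finite_toSet.image fun ω => arcTrace (arc ω)).subset ?_
    rintro C ⟨⟨ω, hω, rfl⟩, -⟩
    exact mem_image_of_mem _ hω
  · rintro C ⟨⟨ω, hω, rfl⟩, hC⟩
    exact ⟨⟨_, hparam ω (hΩnorm ω hω), rfl⟩, hC⟩
  · have hvalid : ∀ ω : ℂ, ∀ D : ℝ, ω ^ m = D → |D| = 1 → (x = 1 → D ≤ 0) → (x = -1 → 0 ≤ D) →
        ω ∈ Ω ∧ arcTrace (arc ω) ⊆ inverseImage T := by
      intro ω D hD hD1 ha hb
      have hω1 := norm_eq_one_of_pow_eq N.pos hD1 hD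
      refine ⟨(hΩ ω).2 ?_, ?_⟩
      · rw [mul_comm, pow_mul, hD, ← Complex.ofReal_pow, ← sq_abs, hD1]; simp
      · rintro _ ⟨s, hs, rfl⟩
        refine ⟨x + D * (r * s) ^ m, ?_, ?_⟩
        · have h3 : 0 ≤ (r * s) ^ m := pow_nonneg (mul_nonneg hr0.le hs.1) m
          have h4 : (r * s) ^ m ≤ r ^ m :=
            pow_le_pow_left₀ (mul_nonneg hr0.le hs.1) (mul_le_of_le_one_right hr0.le hs.2) m
          rcases (abs_eq zero_le_one).1 hD1 with rfl | rfl
          · have h5 := hr1 fun h => absurd (ha h) (by norm_num)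
            constructor <;> linarith [hx.1, hx.2]
          · have h5 := hr2 fun h => absurd (hb h) (by norm_num)
            constructor <;> linarith [hx.1, hx.2]
        · simp only [harc]
          rw [(hRw _ (hball ω hω1 s hs)).2.2.2, hxe, mul_right_comm, mul_pow, hD]
          push_cast
          ring
    have hφ : ∀ᶠ z in 𝓝 z₀, φ z ∈ Metric.ball (0 : ℂ) r := by
      have := N.analytic.continuousAt.tendsto
      rw [N.apply_base] at this
      exact this (Metric.ball_mem_nhds 0 hr0)
    filter_upwards [nhdsWithin_le_nhds hφ, nhdsWithin_le_nhds N.left_inv,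
      nhdsWithin_le_nhds N.eval_eq, self_mem_nhdsWithin] with z hz1 hz2 hz3 hz4
    rw [mem_ball_zero_iff] at hz1
    suffices h : ∃ ω : ℂ, ∃ D : ℝ, ω ^ m = D ∧ |D| = 1 ∧ (x = 1 → D ≤ 0) ∧ (x = -1 → 0 ≤ D) ∧
        ∃ s ∈ Icc (0 : ℝ) 1, (r * ω * s : ℂ) = φ z by
      obtain ⟨ω, D, hD, hD1, ha, hb, s, hs, hse⟩ := h
      obtain ⟨hωΩ, hsub⟩ := hvalid ω D hD hD1 ha hb
      exact ⟨_, ⟨⟨ω, hωΩ, rfl⟩, hsub⟩, s, hs, by simp only [harc]; rw [hse, hz2]⟩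
    by_cases hw : φ z = 0
    · obtain ⟨D, hD1, ha, hb⟩ : ∃ D : ℝ, |D| = 1 ∧ (x = 1 → D ≤ 0) ∧ (x = -1 → 0 ≤ D) := by
        by_cases h : x = 1
        · exact ⟨-1, by simp, fun _ => by norm_num, fun h' => by norm_num [h] at h'⟩
        · exact ⟨1, by simp, fun h' => absurd h' h, fun _ => by norm_num⟩
      obtain ⟨ω, hω⟩ := IsAlgClosed.exists_pow_nat_eq (D : ℂ) N.pos
      exact ⟨ω, D, hω, hD1, ha, hb, 0, ⟨le_rfl, zero_le_one⟩, by rw [hw]; simp⟩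
    · obtain ⟨y, hy, hye⟩ := hz4
      have hwp : 0 < ‖φ z‖ := norm_pos_iff.2 hw
      have hpow : φ z ^ m = ((y - x : ℝ) : ℂ) := by
        rw [hye, hxe] at hz3
        push_cast
        rw [hz3]; ring
      have hD : (φ z / (‖φ z‖ : ℂ)) ^ m = (((y - x) / ‖φ z‖ ^ m : ℝ) : ℂ) := by
        rw [div_pow, hpow]; push_cast; rfl
      refine ⟨φ z / (‖φ z‖ : ℂ), (y - x) / ‖φ z‖ ^ m, hD, ?_, fun h => ?_, fun h => ?_,
        ‖φ z‖ / r, ⟨by positivity, (div_le_one hr0).2 hz1.le⟩, ?_⟩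
      · have h3 := congrArg norm hpow
        rw [norm_pow, Complex.norm_real, Real.norm_eq_abs] at h3
        rw [abs_div, ← h3, abs_of_pos (pow_pos hwp m), div_self (pow_pos hwp m).ne']
      · exact div_nonpos_of_nonpos_of_nonneg (by linarith [hy.2]) (by positivity)
      · exact div_nonneg (by linarith [hy.1]) (by positivity)
      · have h3 : (‖φ z‖ : ℂ) ≠ 0 := by exact_mod_cast hwp.ne'
        have h4 : (r : ℂ) ≠ 0 := by exact_mod_cast hr0.ne'
        push_cast
        field_simp

theorem exists_isArcCover_of_finite {𝒞 : Set (Set ℂ)} (hf : 𝒞.Finite)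
    (harc : ∀ C ∈ 𝒞, IsAnalyticJordanArc C) :
    ∃ γ : Fin 𝒞.ncard → ℝ → ℂ, IsArcCover (⋃₀ 𝒞) γ := by
  rw [Set.ncard_eq_toFinset_card _ hf]
  set e := hf.toFinset.equivFin
  have h : ∀ i, ∃ γ : ℝ → ℂ, IsAnalyticArcParam γ ∧ arcTrace γ = (e.symm i : Set ℂ) := fun i =>
    harc _ (hf.mem_toFinset.1 (e.symm i).2)
  choose γ hγ htr using h
  refine ⟨γ, hγ, ?_⟩
  ext z
  simp only [mem_iUnion, htr, mem_sUnion]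
  constructor
  · rintro ⟨i, hi⟩
    exact ⟨_, hf.mem_toFinset.1 (e.symm i).2, hi⟩
  · rintro ⟨C, hC, hz⟩
    exact ⟨e ⟨C, hf.mem_toFinset.2 hC⟩, by simpa using hz⟩

theorem exists_isArcCover {T : Polynomial ℂ} (hT : 0 < T.natDegree) :
    ∃ k, ∃ γ : Fin k → ℝ → ℂ, IsArcCover (inverseImage T) γ := by
  have h : ∃ 𝒞 : Set (Set ℂ), 𝒞.Finite ∧
      (∀ C ∈ 𝒞, IsAnalyticJordanArc C ∧ C ⊆ inverseImage T) ∧ inverseImage T ⊆ ⋃₀ 𝒞 := by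
    refine (isCompact_inverseImage hT).induction_on
      (p := fun A => ∃ 𝒞 : Set (Set ℂ), 𝒞.Finite ∧
        (∀ C ∈ 𝒞, IsAnalyticJordanArc C ∧ C ⊆ inverseImage T) ∧ A ⊆ ⋃₀ 𝒞) ?_ ?_ ?_ ?_
    · exact ⟨∅, finite_empty, by simp, by simp⟩
    · rintro A B hAB ⟨𝒞, h1, h2, h3⟩
      exact ⟨𝒞, h1, h2, hAB.trans h3⟩
    · rintro A B ⟨𝒞, h1, h2, h3⟩ ⟨𝒟, h4, h5, h6⟩
      refine ⟨𝒞 ∪ 𝒟, h1.union h4, ?_, ?_⟩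
      · rintro C (hC | hC)
        exacts [h2 C hC, h5 C hC]
      · rw [sUnion_union]
        exact union_subset_union h3 h6
    · intro z hz
      obtain ⟨𝒞, h1, h2, h3⟩ := exists_finite_arcs_nhdsWithin hT hz
      exact ⟨_, h3, 𝒞, h1, h2, Subset.rfl⟩
  obtain ⟨𝒞, h1, h2, h3⟩ := h
  obtain ⟨γ, hγ⟩ := exists_isArcCover_of_finite h1 fun C hC => (h2 C hC).1
  refine ⟨_, γ, ?_⟩
  rwa [Subset.antisymm (sUnion_subset fun C hC => (h2 C hC).2) h3] at hγ

/-- A cover by the least number of arcs has no parallel contacts. -/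
theorem IsArcCover.noParallelContact {T : Polynomial ℂ} (hT : 0 < T.natDegree) {k : ℕ}
    {γ : Fin k → ℝ → ℂ} (hγ : IsArcCover (inverseImage T) γ)
    (hmin : ∀ l < k, ¬ ∃ η : Fin l → ℝ → ℂ, IsArcCover (inverseImage T) η) :
    NoParallelContact γ := by
  intro i j hij s hs t ht hst c hc
  have him : ∀ l, ∀ z ∈ arcTrace (γ l), (T.eval z).im = 0 := fun l z hz =>
    im_eval_of_mem_inverseImage (hγ.trace_subset l hz)
  have harc := isAnalyticJordanArc_union hT (hγ.arc i) (hγ.arc j) (him i) (him j) hs ht hst hc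
  classical
  -- The merged arc takes the place of arc `i` and arc `j` is dropped, which leaves at most `k - 1`
  -- sets.
  set F : Fin k → Set ℂ := fun l =>
    if l = i then arcTrace (γ i) ∪ arcTrace (γ j) else arcTrace (γ l) with hF
  have hFarc : ∀ l, IsAnalyticJordanArc (F l) := fun l => by
    by_cases h : l = i
    · simp only [hF, if_pos h]; exact harc
    · simp only [hF, if_neg h]; exact ⟨_, hγ.arc l, rfl⟩
  have hfin : (F '' {j}ᶜ).Finite := toFinite _
  have hU : ⋃₀ (F '' {j}ᶜ) = inverseImage T := by
    rw [← hγ.union]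
    ext z
    simp only [sUnion_image, mem_iUnion, mem_compl_iff, mem_singleton_iff, exists_prop]
    constructor
    · rintro ⟨l, -, hz⟩
      by_cases h : l = i
      · simp only [hF, if_pos h] at hz
        rcases hz with hz | hz
        exacts [⟨i, hz⟩, ⟨j, hz⟩]
      · simp only [hF, if_neg h] at hz
        exact ⟨l, hz⟩
    · rintro ⟨l, hz⟩
      by_cases hj : l = j
      · subst hj
        exact ⟨i, hij, by simp only [hF, if_true]; exact Or.inr hz⟩
      · refine ⟨l, hj, ?_⟩
        by_cases h : l = i
        · subst h
          simp only [hF, if_true]; exact Or.inl hz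
        · simp only [hF, if_neg h]; exact hz
  obtain ⟨η, hη⟩ := exists_isArcCover_of_finite hfin (by
    rintro _ ⟨l, -, rfl⟩
    exact hFarc l)
  rw [hU] at hη
  refine hmin _ ?_ ⟨η, hη⟩
  calc (F '' {j}ᶜ).ncard ≤ ({j}ᶜ : Set (Fin k)).ncard := ncard_image_le (toFinite _)
    _ < (univ : Set (Fin k)).ncard :=
      ncard_lt_ncard (by rw [ssubset_univ_iff, ne_eq, compl_univ_iff]; simp) (toFinite _)
    _ = k := by rw [ncard_univ, Nat.card_fin]

/-- There is a decomposition whose endpoints are the zeros of odd multiplicity. -/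
theorem exists_isArcDecomposition {T : Polynomial ℂ} (hT : 0 < T.natDegree) :
    ∃ k, ∃ γ : Fin k → ℝ → ℂ, IsArcDecomposition (inverseImage T) γ ∧
      arcEndpoints γ = oddZeros (T ^ 2 - 1) := by
  classical
  have h := exists_isArcCover hT
  -- Minimality is taken among all covers, overlaps allowed; having no parallel contacts then makes
  -- the cover a decomposition.
  obtain ⟨γ, hγ⟩ := Nat.find_spec h
  have hP := hγ.noParallelContact hT fun l hl => Nat.find_min h hl
  exact ⟨_, γ, ⟨hγ, fun i j hij => hP.finite_inter hγ.arc hij⟩,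
    le_antisymm (hγ.arcEndpoints_le hT hP) (hγ.oddZeros_le hT)⟩

/-! ### Subarcs and merging -/

/-- A subarc of an arc corresponds to a parameter interval. -/
theorem IsAnalyticArcParam.exists_interval {γ η : ℝ → ℂ} (hγ : IsAnalyticArcParam γ)
    (hη : IsAnalyticArcParam η) (hsub : arcTrace η ⊆ arcTrace γ) :
    ∃ a b, 0 ≤ a ∧ a < b ∧ b ≤ 1 ∧ γ '' Icc a b = arcTrace η ∧
      (γ a = η 0 ∧ γ b = η 1 ∨ γ a = η 1 ∧ γ b = η 0) := by
  have hγc := continuousOn_iff_continuous_domRestrict.1 hγ.analytic.continuousOn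
  have hηc := continuousOn_iff_continuous_domRestrict.1 hη.analytic.continuousOn
  have hinj : Function.Injective ((Icc (0 : ℝ) 1).domRestrict γ) := fun s t h =>
    Subtype.ext (hγ.injective s.2 t.2 h)
  have hemb := (hγc.isClosedEmbedding hinj).isEmbedding
  have hex : ∀ t : Icc (0 : ℝ) 1, ∃ s : Icc (0 : ℝ) 1, γ s = η t := fun t => by
    obtain ⟨s, hs, hse⟩ := hsub (mem_image_of_mem η t.2)
    exact ⟨⟨s, hs⟩, hse⟩
  choose p hp using hex
  -- A continuous injection of a compact interval is an embedding, so the change of parameter is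
  -- continuous. Being injective, it is strictly monotone and maps `[0,1]` onto an interval with the
  -- endpoints matched.
  have hpc : Continuous p := by
    rw [hemb.continuous_iff]
    have : (Icc (0 : ℝ) 1).domRestrict γ ∘ p = (Icc (0 : ℝ) 1).domRestrict η := funext hp
    rwa [this]
  set P : ℝ → ℝ := fun t => p (projIcc 0 1 zero_le_one t) with hPdef
  have hPc : Continuous P := continuous_subtype_val.comp (hpc.comp continuous_projIcc)
  have hPγ : ∀ t ∈ Icc (0 : ℝ) 1, γ (P t) = η t := fun t ht => by
    simp only [hPdef]
    rw [hp, projIcc_of_mem zero_le_one ht]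
  have hPm : ∀ t, P t ∈ Icc (0 : ℝ) 1 := fun t => (p _).2
  have hPi : InjOn P (Icc 0 1) := fun s hs t ht h =>
    hη.injective hs ht (by rw [← hPγ s hs, ← hPγ t ht, h])
  have h0 : (0 : ℝ) ∈ Icc (0 : ℝ) 1 := left_mem_Icc.2 zero_le_one
  have h1 : (1 : ℝ) ∈ Icc (0 : ℝ) 1 := right_mem_Icc.2 zero_le_one
  have himg : ∀ A : Set ℝ, P '' Icc 0 1 = A → γ '' A = arcTrace η := by
    rintro A rfl
    rw [← image_comp]
    exact image_congr hPγ
  rcases hPc.continuousOn.strictMonoOn_of_injOn_Icc' zero_le_one hPi with hm | hm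
  · refine ⟨P 0, P 1, (hPm 0).1, hm h0 h1 zero_lt_one, (hPm 1).2, himg _ ?_,
      Or.inl ⟨hPγ 0 h0, hPγ 1 h1⟩⟩
    refine Subset.antisymm ?_ (intermediate_value_Icc zero_le_one hPc.continuousOn)
    rintro _ ⟨t, ht, rfl⟩
    exact ⟨hm.monotoneOn h0 ht ht.1, hm.monotoneOn ht h1 ht.2⟩
  · refine ⟨P 1, P 0, (hPm 1).1, hm h0 h1 zero_lt_one, (hPm 0).2, himg _ ?_,
      Or.inr ⟨hPγ 1 h1, hPγ 0 h0⟩⟩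
    refine Subset.antisymm ?_ (intermediate_value_Icc' zero_le_one hPc.continuousOn)
    rintro _ ⟨t, ht, rfl⟩
    exact ⟨hm.antitoneOn ht h1 ht.2, hm.antitoneOn h0 ht ht.1⟩

theorem eq_of_Icc_union_of_le {a₁ b₁ a₂ b₂ : ℝ} (h₁ : a₁ < b₁) (h₂ : a₂ < b₂) (ha : a₁ ≤ a₂)
    (hu : Icc a₁ b₁ ∪ Icc a₂ b₂ = Icc 0 1) (hf : (Icc a₁ b₁ ∩ Icc a₂ b₂).Finite) :
    b₁ = a₂ ∧ Icc a₁ b₁ ∩ Icc a₂ b₂ = {a₂} ∧ a₂ ∈ Ioo (0 : ℝ) 1 := by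
  have m₁ : a₁ ∈ Icc (0 : ℝ) 1 := hu ▸ Or.inl ⟨le_rfl, h₁.le⟩
  have m₂ : b₂ ∈ Icc (0 : ℝ) 1 := hu ▸ Or.inr ⟨h₂.le, le_rfl⟩
  have hge : a₂ ≤ b₁ := by
    by_contra! h
    have hm : (b₁ + a₂) / 2 ∈ Icc (0 : ℝ) 1 :=
      ⟨by linarith [m₁.1], by linarith [m₂.2]⟩
    rw [← hu] at hm
    rcases hm with hm | hm
    · linarith [hm.2]
    · linarith [hm.1]
  have hle : b₁ ≤ a₂ := by
    by_contra! h
    have hlt : a₂ < min b₁ b₂ := lt_min h h₂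
    exact (Icc_infinite hlt) (hf.subset fun t ht =>
      ⟨⟨ha.trans ht.1, ht.2.trans (min_le_left _ _)⟩, ⟨ht.1, ht.2.trans (min_le_right _ _)⟩⟩)
  have he := le_antisymm hle hge
  subst he
  refine ⟨rfl, ?_, by linarith [m₁.1], by linarith [m₂.2]⟩
  ext t
  simp only [mem_inter_iff, mem_Icc, mem_singleton_iff]
  constructor
  · rintro ⟨h3, h4⟩
    exact le_antisymm h3.2 h4.1
  · rintro rfl
    exact ⟨⟨h₁.le, le_rfl⟩, le_rfl, h₂.le⟩

/-- Two arcs with finite intersection whose union is an arc meet exactly in one common endpoint,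
which is an interior point of the union. -/
theorem exists_common_endpoint {γ γ₁ γ₂ : ℝ → ℂ} (hγ : IsAnalyticArcParam γ)
    (h₁ : IsAnalyticArcParam γ₁) (h₂ : IsAnalyticArcParam γ₂)
    (hfin : (arcTrace γ₁ ∩ arcTrace γ₂).Finite) (hu : arcTrace γ = arcTrace γ₁ ∪ arcTrace γ₂) :
    ∃ s ∈ Ioo (0 : ℝ) 1, arcTrace γ₁ ∩ arcTrace γ₂ = {γ s} ∧
      (γ s = γ₁ 0 ∨ γ s = γ₁ 1) ∧ (γ s = γ₂ 0 ∨ γ s = γ₂ 1) := by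
  obtain ⟨a₁, b₁, ha₁, hab₁, hb₁, htr₁, he₁⟩ := hγ.exists_interval h₁ (hu ▸ subset_union_left)
  obtain ⟨a₂, b₂, ha₂, hab₂, hb₂, htr₂, he₂⟩ := hγ.exists_interval h₂ (hu ▸ subset_union_right)
  have hs₁ : Icc a₁ b₁ ⊆ Icc 0 1 := Icc_subset_Icc ha₁ hb₁
  have hs₂ : Icc a₂ b₂ ⊆ Icc 0 1 := Icc_subset_Icc ha₂ hb₂
  have hunion : Icc a₁ b₁ ∪ Icc a₂ b₂ = Icc 0 1 := by
    refine (hγ.injective.image_eq_image_iff (union_subset hs₁ hs₂) Subset.rfl).1 ?_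
    rw [image_union, htr₁, htr₂, ← hu]; rfl
  have hinter : γ '' (Icc a₁ b₁ ∩ Icc a₂ b₂) = arcTrace γ₁ ∩ arcTrace γ₂ := by
    rw [hγ.injective.image_inter hs₁ hs₂, htr₁, htr₂]
  have hf : (Icc a₁ b₁ ∩ Icc a₂ b₂).Finite := by
    rw [← hinter] at hfin
    exact hfin.of_finite_image (hγ.injective.mono (inter_subset_left.trans hs₁))
  rw [← hinter]
  rcases le_total a₁ a₂ with h | h
  · obtain ⟨rfl, hi, hm⟩ := eq_of_Icc_union_of_le hab₁ hab₂ h hunion hf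
    refine ⟨b₁, hm, by rw [hi, image_singleton], ?_, ?_⟩
    · rcases he₁ with ⟨-, h⟩ | ⟨-, h⟩
      exacts [Or.inr h, Or.inl h]
    · rcases he₂ with ⟨h, -⟩ | ⟨h, -⟩
      exacts [Or.inl h, Or.inr h]
  · rw [union_comm] at hunion
    rw [inter_comm] at hf ⊢
    obtain ⟨rfl, hi, hm⟩ := eq_of_Icc_union_of_le hab₂ hab₁ h hunion hf
    refine ⟨b₂, hm, by rw [hi, image_singleton], ?_, ?_⟩
    · rcases he₁ with ⟨h, -⟩ | ⟨h, -⟩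
      exacts [Or.inl h, Or.inr h]
    · rcases he₂ with ⟨-, h⟩ | ⟨-, h⟩
      exacts [Or.inr h, Or.inl h]

/-! ### The main theorem -/

theorem theorem1 (n : ℕ) (hn : 1 ≤ n) (T : Polynomial ℂ) (hT : T.natDegree = n) :
    -- the equivalence
    (∀ (ν : ℕ) (b : Fin (2 * ν) → ℂ),
      ((∃ γ : Fin ν → ℝ → ℂ, IsArcDecomposition (inverseImage T) γ ∧
          arcEndpoints γ = Finset.univ.val.map b) ∧
        (∀ k < ν, ¬ ∃ γ : Fin k → ℝ → ℂ, IsArcDecomposition (inverseImage T) γ)) ↔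
      oddZeros (T ^ 2 - 1) = Finset.univ.val.map b) ∧
    -- the minimality holds even among families of arcs that may overlap
    (∀ (k : ℕ) (γ : Fin k → ℝ → ℂ), IsArcCover (inverseImage T) γ →
      (oddZeros (T ^ 2 - 1)).card ≤ 2 * k) ∧
    -- two arcs can be merged into one only at a zero of even multiplicity
    (∀ γ₁ γ₂ : ℝ → ℂ, IsAnalyticArcParam γ₁ → IsAnalyticArcParam γ₂ →
      arcTrace γ₁ ⊆ inverseImage T → arcTrace γ₂ ⊆ inverseImage T →
      (T ^ 2 - 1).IsRoot (γ₁ 0) → (T ^ 2 - 1).IsRoot (γ₁ 1) →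
      (T ^ 2 - 1).IsRoot (γ₂ 0) → (T ^ 2 - 1).IsRoot (γ₂ 1) →
      (arcTrace γ₁ ∩ arcTrace γ₂).Finite →
      IsAnalyticJordanArc (arcTrace γ₁ ∪ arcTrace γ₂) →
      ∃ z₀ : ℂ, arcTrace γ₁ ∩ arcTrace γ₂ = {z₀} ∧
        (z₀ = γ₁ 0 ∨ z₀ = γ₁ 1) ∧ (z₀ = γ₂ 0 ∨ z₀ = γ₂ 1) ∧
        (T ^ 2 - 1).IsRoot z₀ ∧ Even ((T ^ 2 - 1).rootMultiplicity z₀)) := by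
  have hT0 : 0 < T.natDegree := by omega
  have hcover : ∀ (k : ℕ) (γ : Fin k → ℝ → ℂ), IsArcCover (inverseImage T) γ →
      (oddZeros (T ^ 2 - 1)).card ≤ 2 * k := fun k γ hγ => by
    rw [← card_arcEndpoints γ]
    exact Multiset.card_le_card (hγ.oddZeros_le hT0)
  obtain ⟨κ, η, hη, hηe⟩ := exists_isArcDecomposition hT0
  have hcard : (oddZeros (T ^ 2 - 1)).card = 2 * κ := by rw [← hηe, card_arcEndpoints]
  refine ⟨fun ν b => ⟨?_, fun hb => ?_⟩, hcover, ?_⟩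
  · rintro ⟨⟨γ, hγ, hγb⟩, hmin⟩
    -- Minimality bounds the `2 * ν` endpoints by the `2 * κ` odd zeros, so the inclusion of the odd
    -- zeros in the endpoints is an equality.
    have hν : ν ≤ κ := by
      by_contra! h
      exact hmin κ h ⟨η, hη⟩
    rw [← hγb]
    refine Multiset.eq_of_le_of_card_le (hγ.toIsArcCover.oddZeros_le hT0) ?_
    rw [card_arcEndpoints, hcard]
    omega
  · have hκ : κ = ν := by
      have := congrArg Multiset.card hb
      rw [hcard] at this
      simp at this
      exact this
    subst hκ
    refine ⟨⟨η, hη, hηe.trans hb⟩, ?_⟩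
    rintro k hk ⟨γ, hγ⟩
    have := hcover k γ hγ.toIsArcCover
    omega
  · rintro γ₁ γ₂ h₁ h₂ hS₁ hS₂ hr₁ hr₁' - - hfin ⟨γ, hγ, hγu⟩
    obtain ⟨s, hs, hi, he₁, he₂⟩ := exists_common_endpoint hγ h₁ h₂ hfin hγu
    have hroot : (T ^ 2 - 1).IsRoot (γ s) := by
      rcases he₁ with h | h <;> rw [h] <;> assumption
    have hs' := Ioo_subset_Icc_self hs
    refine ⟨γ s, hi, he₁, he₂, hroot, ?_⟩
    -- The common endpoint is an interior point of the merged arc, which lies in `S`.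
    refine even_rootMultiplicity_of_interior hT0 (hγ.analytic s hs').differentiableAt
      (hγ.regular s hs') ?_ hroot
    filter_upwards [Icc_mem_nhds hs.1 hs.2] with t ht
    exact union_subset hS₁ hS₂ (hγu ▸ mem_image_of_mem γ ht)
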